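/- Trajectories and set integrals. Let $d\ge 1$. A trajectory up to time step $k$ is $X=(t,x^{1:\nu})$ with start time $t$, length $\nu$, $0\le t\le k$, $1\le\nu\le k-t+1$, and states $x^1,\dots,x^\nu\in\mathbb R^d$; $T_{(k)}$ is the set of these trajectories, $\int\pi(X)\,dX=\sum_{(t,\nu)}\int\pi(t,x^{1:\nu})\,dx^{1:\nu}$, $\langle a,b\rangle=\int a(X)b(X)\,dX$, and $\int\pi(\mathbf X)\,\delta\mathbf X=\sum_{n\ge0}\frac1{n!}\int\pi(\{X_1,\dots,X_n\})\,dX_1\cdots dX_n$ for functions $\pi$ on the finite subsets of $T_{(k)}$. A multi-trajectory density is a nonnegative measurable function on these finite subsets with set integral one. PMB densities. The Poisson multi-Bernoulli (PMB) density with Poisson intensity $\lambda$ (nonnegative, integrable) and $n$ Bernoulli components with existence probabilities $r^i\in[0,1]$ and single-trajectory densities $p^i$ is $$f(\mathbf X)=\sum_{\mathbf Y\uplus\mathbf X^1\uplus\dots\uplus\mathbf X^n=\mathbf X}e^{-\int\lambda(X)dX}\prod_{X\in\mathbf Y}\lambda(X)\ \prod_{i=1}^n f^i(\mathbf X^i),$$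 where $f^i(\emptyset)=1-r^i$, $f^i(\{X\})=r^ip^i(X)$, and $f^i(\mathbf X)=0$ if $|\mathbf X|\ge2$. Dynamic model. Targets survive with probability $p^S(x)$, move with transition density $g(\cdot|x)$, and are born by a Poisson process with (integrable) intensity $\lambda^B$. Let $k\ge1$. Given the set $\mathbf X_{k-1}$ of trajectories at time step $k-1$, each $X=(t,x^{1:\nu})\in\mathbf X_{k-1}$, independently of the others, remains with probability $p^S(X)$ and becomes a trajectory $Y=(t_y,y^{1:\nu_y})$ with transition density $g_k(Y|X)$, or else disappears; $\mathbf X_k$ is the union of these trajectories and of an independent Poisson process with intensity $\lambda_k^B(t,x^{1:\nu})=\delta_k[t]\,\delta_1[\nu]\,\lambda^B(x^\nu)$. There are two problem formulations. * Alive trajectories (those with $t+\nu-1$ equal to the current time step): $p^S(X)=p^S(x^\nu)$ and $g_k(Y|X)=\delta_t[t_y]\,\delta_{\nu+1}[\nu_y]\,\delta_{x^{1:\nu}}(y^{1:\nu_y-1})\,g(y^{\nu_y}|x^\nu)$. * All trajectories: $p^S(X)=1$ and, with $\omega_y=t_y+\nu_y-1$, $g_k(Y|X)=\delta_t[t_y]$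 times $\delta_\nu[\nu_y]\,\delta_{x^{1:\nu}}(y^{1:\nu_y})$ if $\omega_y<k-1$; $\delta_\nu[\nu_y]\,\delta_{x^{1:\nu}}(y^{1:\nu_y})\,(1-p^S(x^\nu))$ if $\omega_y=k-1$; $\delta_{\nu+1}[\nu_y]\,\delta_{x^{1:\nu}}(y^{1:\nu_y-1})\,p^S(x^\nu)\,g(y^{\nu_y}|x^\nu)$ if $\omega_y=k$. Lemma (TPMB prediction). In either formulation, suppose that the filtering density of the set of (alive or all) trajectories at time step $k-1$ is a PMB density with intensity $\lambda_{k-1|k-1}$ and $n$ Bernoulli components with parameters $r^i_{k-1|k-1}$, $p^i_{k-1|k-1}$. Then the predicted set of (alive or all) trajectories at time step $k$ has a density, which is the PMB density with the same number $n$ of Bernoulli components and parameters $$\lambda_{k|k-1}(X)=\lambda_k^B(X)+\langle\lambda_{k-1|k-1},\,g_k(X|\cdot)\,p^S(\cdot)\rangle,$$ $$r^i_{k|k-1}=r^i_{k-1|k-1}\langle p^i_{k-1|k-1},p^S\rangle,\qquad p^i_{k|k-1}(X)=\frac{\langle p^i_{k-1|k-1},\,g_k(X|\cdot)\,p^S(\cdot)\rangle}{\langle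 p^i_{k-1|k-1},p^S\rangle}.$$ Here $\lambda_{k|k-1}$ is nonnegative and integrable, $r^i_{k|k-1}\in[0,1]$, and $p^i_{k|k-1}$ is a probability density whenever $\langle p^i_{k-1|k-1},p^S\rangle\ne0$; if $\langle p^i_{k-1|k-1},p^S\rangle=0$, then $r^i_{k|k-1}=0$ and $p^i_{k|k-1}$, which plays no role, is read as $0$. -/

import Mathlib

open MeasureTheory
open scoped ENNReal

namespace TrajectoryPMB

noncomputable section

/-! ### Finite subsets, set integrals and densities -/

/-- The space of all finite subsets of `α`. It is a type of its own, and not `Finset α`, because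
the measurable structure that Mathlib puts on `Finset α` is not the one of random finite sets. -/
@[ext]
structure FinSets (α : Type*) where
  /-- the underlying finite set -/
  toFinset : Finset α

open Classical in
/-- The finite set `{X₁, …, Xₙ}` of the entries of a tuple. -/
def FinSets.ofTuple {α : Type*} {n : ℕ} (x : Fin n → α) : FinSets α :=
  ⟨Finset.univ.image x⟩

/-- A family `S` of finite subsets is measurable if, for every `n`, the set of the
`n`-tuples `(X₁, …, Xₙ)` with `{X₁, …, Xₙ} ∈ S` is measurable in `αⁿ`. -/
instance FinSets.instMeasurableSpace {α : Type*} [MeasurableSpace α] :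
    MeasurableSpace (FinSets α) :=
  ⨅ n : ℕ, MeasurableSpace.map (FinSets.ofTuple (n := n)) (inferInstance : MeasurableSpace (Fin n → α))

/-- The reference measure of the set integral:
`∫ π(𝐗) δ𝐗 = ∑ₙ (1 / n!) ∫ π({X₁, …, Xₙ}) dX₁ ⋯ dXₙ`, where `dX` is the measure `μ`. -/
def setMeasure {α : Type*} [MeasurableSpace α] (μ : Measure α) : Measure (FinSets α) :=
  Measure.sum fun n : ℕ =>
    ((n.factorial : ℝ≥0∞)⁻¹) • (Measure.pi fun _ : Fin n => μ).map FinSets.ofTuple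

/-- `f` is a multi-object density: measurable, nonnegative, and with set integral one. -/
structure IsMultiObjectDensity {α : Type*} [MeasurableSpace α] (μ : Measure α)
    (f : FinSets α → ℝ) : Prop where
  measurable : Measurable f
  nonneg : ∀ S, 0 ≤ f S
  lintegral_eq_one : ∫⁻ S, ENNReal.ofReal (f S) ∂(setMeasure μ) = 1

/-- The law `P` of a random finite set has the multi-object density `f`. -/
def HasMultiObjectDensity {α : Type*} [MeasurableSpace α] (μ : Measure α)
    (P : Measure (FinSets α)) (f : FinSets α → ℝ) : Prop :=
  IsMultiObjectDensity μ f ∧ P = (setMeasure μ).withDensity fun S => ENNReal.ofReal (f S)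

/-! ### Poisson multi-Bernoulli densities -/

/-- Density of a Poisson point process with intensity `lam`: `e^{-∫ lam} ∏_{X ∈ 𝐗} lam X`. -/
def poissonDensity {α : Type*} [MeasurableSpace α] (μ : Measure α) (lam : α → ℝ)
    (S : Finset α) : ℝ :=
  Real.exp (-∫ X, lam X ∂μ) * ∏ X ∈ S, lam X

/-- Density of a Bernoulli random finite set: `1 - r` at `∅`, `r * p X` at `{X}`, and `0` at the
sets with two or more elements. -/
def bernoulliDensity {α : Type*} (r : ℝ) (p : α → ℝ) (S : Finset α) : ℝ :=
  if S.card = 0 then 1 - r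
  else if S.card = 1 then r * ∏ X ∈ S, p X
  else 0

open Classical in
/-- All ways to write `S` as a disjoint union of possibly empty sets `Z none` (the Poisson part)
and `Z (some i)`, `i < n` (the Bernoulli parts). -/
def decompositions {α : Type*} (n : ℕ) (S : Finset α) : Finset (Option (Fin n) → Finset α) :=
  (Fintype.piFinset fun _ : Option (Fin n) => S.powerset).filter fun Z =>
    (∀ i j, i ≠ j → Disjoint (Z i) (Z j)) ∧ Finset.univ.biUnion Z = S

/-- The Poisson multi-Bernoulli density with Poisson intensity `lam` and `n` Bernoulli components,
the `i`-th with probability of existence `r i` and single-object density `p i`. -/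
def pmbDensity {α : Type*} [MeasurableSpace α] (μ : Measure α) {n : ℕ}
    (lam : α → ℝ) (r : Fin n → ℝ) (p : Fin n → α → ℝ) (S : FinSets α) : ℝ :=
  ∑ Z ∈ decompositions n S.toFinset,
    poissonDensity μ lam (Z none) * ∏ i : Fin n, bernoulliDensity (r i) (p i) (Z (some i))

/-- Intensity functions of Poisson point processes with finitely many points. -/
structure IsIntensity {α : Type*} [MeasurableSpace α] (μ : Measure α) (lam : α → ℝ) : Prop where
  measurable : Measurable lam
  nonneg : ∀ X, 0 ≤ lam X
  integrable : Integrable lam μ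

/-- Probability densities on the single-object space. -/
structure IsDensity {α : Type*} [MeasurableSpace α] (μ : Measure α) (p : α → ℝ) : Prop where
  measurable : Measurable p
  nonneg : ∀ X, 0 ≤ p X
  integral_eq_one : ∫ X, p X ∂μ = 1

/-! ### Trajectories -/

/-- Single target states, `ℝ^d`. -/
abbrev State (d : ℕ) : Type := EuclideanSpace ℝ (Fin d)

/-- The pairs (start time, length) `(t, ν)` of the trajectories up to time step `k`:
`0 ≤ t ≤ k` and `1 ≤ ν ≤ k - t + 1`. -/
abbrev TrajIndex (k : ℕ) : Type := {i : ℕ × ℕ // i.1 ≤ k ∧ 1 ≤ i.2 ∧ i.2 ≤ k - i.1 + 1}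

/-- The single-trajectory space up to time step `k`: the disjoint union over `(t, ν)` of the
spaces `{t} × (ℝ^d)^ν`. -/
abbrev Traj (d k : ℕ) : Type := Σ i : TrajIndex k, (Fin i.1.2 → State d)

/-- The measure `dX` of the single-trajectory integral
`∫ π(X) dX = ∑_{(t, ν)} ∫ π(t, x^{1:ν}) dx^{1:ν}`. -/
def trajMeasure (d k : ℕ) : Measure (Traj d k) :=
  Measure.sum fun i : TrajIndex k => (volume : Measure (Fin i.1.2 → State d)).map (Sigma.mk i)

namespace Traj

variable {d k : ℕ}

/-- The start time `t`. -/
def start (X : Traj d k) : ℕ := X.1.1.1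

/-- The length `ν`. -/
def len (X : Traj d k) : ℕ := X.1.1.2

/-- The last time step `t + ν - 1` at which the trajectory exists. -/
def endTime (X : Traj d k) : ℕ := X.start + X.len - 1

/-- The last state `x^ν`. -/
def last (X : Traj d k) : State d :=
  X.2 ⟨X.1.1.2 - 1, by have h := X.1.2.2.1; omega⟩

/-- The same trajectory, as a trajectory up to time step `k + 1`. -/
def keep (X : Traj d k) : Traj d (k + 1) :=
  ⟨⟨X.1.1, by have h := X.1.2; omega⟩, X.2⟩

/-- The trajectory `(t, (x^{1:ν}, y))`. -/
def extend (X : Traj d k) (y : State d) : Traj d (k + 1) :=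
  ⟨⟨(X.1.1.1, X.1.1.2 + 1), by have h := X.1.2; dsimp only; omega⟩,
    Fin.snoc (α := fun _ => State d) X.2 y⟩

/-- A trajectory that ends by time step `k`, as a trajectory up to time step `k`. -/
def unkeep (Y : Traj d (k + 1)) (h : Y.endTime ≤ k) : Traj d k :=
  ⟨⟨Y.1.1, by
    have h1 := Y.1.2
    simp only [endTime, start, len] at h
    omega⟩, Y.2⟩

/-- The trajectory `(t, y^{1:ν-1})`, for a trajectory `(t, y^{1:ν})` with `ν ≥ 2`. -/
def trunc (Y : Traj d (k + 1)) (h : 2 ≤ Y.len) : Traj d k :=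
  ⟨⟨(Y.1.1.1, Y.1.1.2 - 1), by
    have h1 := Y.1.2
    simp only [len] at h
    dsimp only
    omega⟩,
    fun j => Y.2 ⟨j.1, by have h2 := j.2; dsimp only at h2; omega⟩⟩

end Traj

/-! ### Dynamic models -/

/-- The dynamic model of the targets: probability of survival, transition density, and
birth intensity. -/
structure TargetModel (d : ℕ) where
  /-- the probability `p^S(x)` of survival of a target with state `x` -/
  pS : State d → ℝ
  /-- the transition density `g y x = g(y | x)` -/
  g : State d → State d → ℝ
  /-- the intensity `λ^B` of the Poisson process of the new born targets -/
  birth : State d → ℝ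
  measurable_pS : Measurable pS
  pS_nonneg : ∀ x, 0 ≤ pS x
  pS_le_one : ∀ x, pS x ≤ 1
  measurable_g : Measurable fun z : State d × State d => g z.1 z.2
  isDensity_g : ∀ x, IsDensity volume fun y => g y x
  isIntensity_birth : IsIntensity volume birth

/-- The two problem formulations: the set of alive trajectories, the set of all trajectories. -/
inductive Formulation
  | alive
  | all

/-- The trajectories that may belong to the considered set at time step `k`: those that exist at
time step `k` for alive trajectories, and every trajectory up to time step `k` for all
trajectories. -/
def Formulation.Admits {d : ℕ} (F : Formulation) (k : ℕ) (X : Traj d k) : Prop :=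
  match F with
  | .alive => X.endTime = k
  | .all => True

variable {d : ℕ}

/-- The probability that a trajectory remains in the considered set. -/
def survival (M : TargetModel d) (F : Formulation) {k : ℕ} (X : Traj d k) : ℝ :=
  match F with
  | .alive => M.pS X.last
  | .all => 1

/-- The law of the trajectory obtained by appending to `X` a new state drawn
from `g(· | x^ν)`. -/
def appendLaw (M : TargetModel d) {k : ℕ} (X : Traj d k) : Measure (Traj d (k + 1)) :=
  ((volume : Measure (State d)).withDensity fun y => ENNReal.ofReal (M.g y X.last)).map X.extend

/-- The law `g_{k+1}(Y | X) dY` of the trajectory at time step `k + 1` of a trajectory `X` that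
remains in the considered set. -/
def transition (M : TargetModel d) (F : Formulation) {k : ℕ} (X : Traj d k) :
    Measure (Traj d (k + 1)) :=
  match F with
  | .alive => appendLaw M X
  | .all =>
    if X.endTime = k then
      ENNReal.ofReal (1 - M.pS X.last) • Measure.dirac X.keep
        + ENNReal.ofReal (M.pS X.last) • appendLaw M X
    else Measure.dirac X.keep

/-- The intensity of the new born trajectories at time step `k`:
`λ_k^B(t, x^{1:ν}) = δ_k[t] δ_1[ν] λ^B(x^ν)`. -/
def birthIntensity (M : TargetModel d) (k : ℕ) (X : Traj d k) : ℝ :=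
  if X.start = k ∧ X.len = 1 then M.birth X.last else 0

/-- What becomes of a single trajectory `X` of the considered set: with probability `p^S(X)` it
remains, as a trajectory `inl Y` with `Y` drawn from `g_{k+1}(· | X)`, and with probability
`1 - p^S(X)` it disappears (`inr ()`). -/
def fateLaw (M : TargetModel d) (F : Formulation) {k : ℕ} (X : Traj d k) :
    Measure (Traj d (k + 1) ⊕ Unit) :=
  ENNReal.ofReal (survival M F X) • (transition M F X).map Sum.inl
    + ENNReal.ofReal (1 - survival M F X) • Measure.dirac (Sum.inr ())

open Classical in
/-- The union of the surviving trajectories and of the new born trajectories `b₁, …, bₙ`. -/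
def nextSet {k n : ℕ} (S : FinSets (Traj d k))
    (ω : (S.toFinset → Traj d (k + 1) ⊕ Unit) × (Fin n → Traj d (k + 1))) :
    FinSets (Traj d (k + 1)) :=
  ⟨(Finset.univ.biUnion fun X => Sum.elim (fun Y => {Y}) (fun _ => ∅) (ω.1 X))
    ∪ Finset.univ.image ω.2⟩

/-- The Markov transition of the set of trajectories, from time step `k` to `k + 1`: the law of the
union of the surviving trajectories, which evolve independently, and of an independent Poisson
point process of new born trajectories with intensity `λ_{k+1}^B`. A Poisson process with intensity
`λ` consists of `n` points placed by the measure `e^{-∫ λ} / n! • (λ(X) dX)^{⊗ n}`, `n = 0, 1, …`. -/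
def multiTransition (M : TargetModel d) (F : Formulation) {k : ℕ} (S : FinSets (Traj d k)) :
    Measure (FinSets (Traj d (k + 1))) :=
  Measure.sum fun n : ℕ =>
    (ENNReal.ofReal
        (Real.exp (-∫ X, birthIntensity M (k + 1) X ∂(trajMeasure d (k + 1)))) / n.factorial) •
      ((Measure.pi fun X : S.toFinset => fateLaw M F X.1).prod
        (Measure.pi fun _ : Fin n => (trajMeasure d (k + 1)).withDensity
          fun X => ENNReal.ofReal (birthIntensity M (k + 1) X))).map (nextSet S)

/-- The prediction step: the law of the set of trajectories at time step `k + 1`, if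
`P` is its law at time step `k`. -/
def predict (M : TargetModel d) (F : Formulation) {k : ℕ} (P : Measure (FinSets (Traj d k))) :
    Measure (FinSets (Traj d (k + 1))) :=
  P.bind (multiTransition M F)

/-! ### Pairings -/

/-- `⟨a, b⟩ = ∫ a(X) b(X) dX`. -/
def pairing {k : ℕ} (a b : Traj d k → ℝ) : ℝ :=
  ∫ X, a X * b X ∂(trajMeasure d k)

/-- For a fixed `Y = (t_y, y^{1:ν_y})`, the Dirac measure
`δ_{t}[t_y] δ_{ν+1}[ν_y] δ_{x^{1:ν}}(y^{1:ν_y-1}) dX` in `X = (t, x^{1:ν})`. It is zero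
if `ν_y = 1`. -/
def truncDirac {k : ℕ} (Y : Traj d (k + 1)) : Measure (Traj d k) :=
  if h : 2 ≤ Y.len then Measure.dirac (Y.trunc h) else 0

/-- The state `y^{ν_y - 1}` before the last one (`y^1` if `ν_y = 1`). -/
def prevState {k : ℕ} (Y : Traj d k) : State d :=
  Y.2 ⟨Y.1.1.2 - 2, by have h := Y.1.2.2.1; omega⟩

/-- For a fixed `Y`, the measure `g_{k+1}(Y | X) dX` in `X`. The transition density contains
Dirac deltas `δ_x(y)`, which are symmetric in `x` and `y`, so that `δ_x(y) dx` is the Dirac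
measure at `y`. -/
def transitionAt (M : TargetModel d) (F : Formulation) {k : ℕ} (Y : Traj d (k + 1)) :
    Measure (Traj d k) :=
  match F with
  | .alive => ENNReal.ofReal (M.g Y.last (prevState Y)) • truncDirac Y
  | .all =>
    if h : Y.endTime ≤ k then
      if Y.endTime < k then Measure.dirac (Y.unkeep h)
      else ENNReal.ofReal (1 - M.pS Y.last) • Measure.dirac (Y.unkeep h)
    else ENNReal.ofReal (M.pS (prevState Y) * M.g Y.last (prevState Y)) • truncDirac Y

/-- `⟨a, g_{k+1}(Y | ·) p^S(·)⟩ = ∫ a(X) g_{k+1}(Y | X) p^S(X) dX`. -/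
def transitionPairing (M : TargetModel d) (F : Formulation) {k : ℕ} (a : Traj d k → ℝ)
    (Y : Traj d (k + 1)) : ℝ :=
  ∫ X, a X * survival M F X ∂(transitionAt M F Y)

/-! ### Predicted parameters -/

/-- The predicted Poisson intensity. -/
def predIntensity (M : TargetModel d) (F : Formulation) {k : ℕ} (lam : Traj d k → ℝ)
    (Y : Traj d (k + 1)) : ℝ :=
  birthIntensity M (k + 1) Y + transitionPairing M F lam Y

/-- The predicted probability of existence of a Bernoulli component. -/
def predExistence (M : TargetModel d) (F : Formulation) {k : ℕ} (r : ℝ) (p : Traj d k → ℝ) : ℝ :=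
  r * pairing p (survival M F)

/-- The predicted single-trajectory density of a Bernoulli component. -/
def predDensity (M : TargetModel d) (F : Formulation) {k : ℕ} (p : Traj d k → ℝ)
    (Y : Traj d (k + 1)) : ℝ :=
  transitionPairing M F p Y / pairing p (survival M F)

end

end TrajectoryPMB

/-!
The idea is to test all laws of random finite sets against measurable functions
`ψ : FinSets α → ℝ≥0∞`, and to describe the PMB densities and the Markov transition by operators on
these test functions. For a measure `a` on `α ⊕ Unit`, let `D_a ψ (S) = ∫ ψ(S ∪ z) a(dz)`, where
`z = inl X` adjoins `X` and `z = inr ()` adjoins nothing (`adjoinOp`). These operators commute, they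
are additive in `a`, and `D_{c δ}` is multiplication by `c` if `δ` is the Dirac measure
at `inr ()`.

* The set integral of `ψ` against a PMB density is `D_{b₁} ⋯ D_{bₙ} e^{-∫ λ} exp(D_λ) ψ` at the
  empty set, where `bᵢ` is the law of the `i`-th Bernoulli component. Its two ingredients are
  `lintegral_pmbDensity_zero`, for the Poisson part, and `lintegral_pmbDensity_succ`, which removes
  one Bernoulli component. The latter rests on the recursion `pmbDensity_succ` and on the formula
  `lintegral_setMeasure_sum_erase` for set integrals over sets with a distinguished element.
* Let `Φ ψ (S)` be the expectation of `ψ` at the next set if the current one is `S`. If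
  `X ∉ S`, then `Φ ψ (S ∪ {X}) = Φ (D_{q X} ψ) (S)`, where `q X` is the law of the fate of `X`.
  The single-trajectory measure has no atoms and `S` is finite, so that integration over `X`
  gives `D_a Φ = Φ D_{a q}` (`adjoinOp_multiTransitionOp`). At the empty set, `Φ` is the Poisson
  process of the new born trajectories (`multiTransitionOp_empty`).
* Hence `Φ` can be moved through all the operators, which replaces each law by the law of the fates.
  By `lintegral_transition` and `bind_fateKernel`, the fate of a Bernoulli component is a Bernoulli
  component with the predicted parameters. The fate of the Poisson part is the measure `⟨λ, g p^S⟩`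
  and a multiple `c δ` of the Dirac measure. Since the exponential series of commuting operators
  multiply (`expAtEmpty_add`), `c δ` only contributes the normalizing factor `exp c`, and the
  intensity of the surviving trajectories is added to the birth intensity.

The measurable sets of `FinSets α` are defined through tuples that may have repeated entries. As the
diagonal of `α × α` is measurable, it is enough to control the tuples without repetitions
(`FinSets.measurable_of_injective_tuples`), and almost all tuples are of this kind.
-/

namespace TrajectoryPMB

/-! ### Decompositions and the recursion of the PMB density -/

section Combinatorics

variable {α : Type*}

theorem mem_decompositions {n : ℕ} {S : Finset α} {Z : Option (Fin n) → Finset α} :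
    Z ∈ decompositions n S ↔
      (∀ i j, i ≠ j → Disjoint (Z i) (Z j)) ∧ ∀ X, X ∈ S ↔ ∃ i, X ∈ Z i := by
  classical
  simp only [decompositions, Finset.mem_filter, Fintype.mem_piFinset, Finset.mem_powerset,
    Finset.ext_iff, Finset.mem_biUnion, Finset.mem_univ, true_and]
  constructor
  · rintro ⟨-, h1, h2⟩
    exact ⟨h1, fun X => (h2 X).symm⟩
  · rintro ⟨h1, h2⟩
    exact ⟨fun i X hX => (h2 X).2 ⟨i, hX⟩, h1, fun X => (h2 X).symm⟩

variable [MeasurableSpace α] {μ : Measure α} {n : ℕ}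

theorem pmbDensity_zero (lam : α → ℝ) (r : Fin 0 → ℝ) (p : Fin 0 → α → ℝ) (S : FinSets α) :
    pmbDensity μ lam r p S = poissonDensity μ lam S.toFinset := by
  classical
  have h : decompositions 0 S.toFinset = {fun _ => S.toFinset} := by
    ext Z
    rw [mem_decompositions, Finset.mem_singleton]
    constructor
    · rintro ⟨-, h⟩
      funext i
      ext X
      rw [h X]
      exact ⟨fun hX => ⟨i, hX⟩, fun ⟨j, hj⟩ => Subsingleton.elim j i ▸ hj⟩
    · rintro rfl
      exact ⟨fun i j hij => absurd (Subsingleton.elim i j) hij,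
        fun X => ⟨fun hX => ⟨none, hX⟩, fun ⟨_, hX⟩ => hX⟩⟩
  simp [pmbDensity, h]

open Classical in
/-- Splitting off the set `V` that stems from the first Bernoulli component. -/
theorem pmbDensity_succ_eq_sum_powerset (lam : α → ℝ) (r : Fin (n + 1) → ℝ)
    (p : Fin (n + 1) → α → ℝ) (S : FinSets α) :
    pmbDensity μ lam r p S = ∑ V ∈ S.toFinset.powerset, bernoulliDensity (r 0) (p 0) V *
      pmbDensity μ lam (Fin.tail r) (Fin.tail p) ⟨S.toFinset \ V⟩ := by
  simp only [pmbDensity, Finset.mul_sum]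
  rw [Finset.sum_sigma']
  refine Finset.sum_bij' (fun Z _ => ⟨Z (some 0), fun o => Z (o.map Fin.succ)⟩)
    (fun W _ o => o.elim (W.2 none) (Fin.cases W.1 fun i => W.2 (some i))) ?_ ?_ ?_ ?_ ?_
  · intro Z hZ
    rw [mem_decompositions] at hZ
    simp only [Finset.mem_sigma, Finset.mem_powerset, mem_decompositions]
    refine ⟨fun X hX => (hZ.2 X).2 ⟨_, hX⟩, fun i j hij => hZ.1 _ _ fun h =>
      hij (Option.map_injective (Fin.succ_injective n) h), fun X => ?_⟩
    rw [Finset.mem_sdiff, hZ.2 X]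
    constructor
    · rintro ⟨⟨i, hi⟩, h0⟩
      rcases i with _ | i
      · exact ⟨none, hi⟩
      · induction i using Fin.cases with
        | zero => exact absurd hi h0
        | succ i => exact ⟨some i, hi⟩
    · rintro ⟨i, hi⟩
      refine ⟨⟨_, hi⟩, fun h0 => ?_⟩
      refine Finset.disjoint_left.1 (hZ.1 (some 0) (i.map Fin.succ) ?_) h0 hi
      rcases i with _ | i
      · simp
      · simpa using (Fin.succ_ne_zero i).symm
  · rintro ⟨V, W⟩ h
    simp only [Finset.mem_sigma, Finset.mem_powerset, mem_decompositions, Finset.mem_sdiff] at h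
    obtain ⟨hV, hW, hS⟩ := h
    have hVW : ∀ i, Disjoint V (W i) := fun i =>
      Finset.disjoint_right.2 fun X hX => ((hS X).2 ⟨i, hX⟩).2
    rw [mem_decompositions]
    constructor
    · rintro (_ | i) (_ | j) hij
      · exact absurd rfl hij
      · induction j using Fin.cases with
        | zero => exact (hVW none).symm
        | succ j => exact hW none (some j) (by simp)
      · induction i using Fin.cases with
        | zero => exact hVW none
        | succ i => exact hW (some i) none (by simp)
      · induction i using Fin.cases with
        | zero =>
          induction j using Fin.cases with
          | zero => exact absurd rfl hij
          | succ j => exact hVW (some j)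
        | succ i =>
          induction j using Fin.cases with
          | zero => exact (hVW (some i)).symm
          | succ j => exact hW (some i) (some j) fun h => hij (by simpa using h)
    · intro X
      constructor
      · intro hX
        by_cases hXV : X ∈ V
        · exact ⟨some 0, hXV⟩
        · obtain ⟨i, hi⟩ := (hS X).1 ⟨hX, hXV⟩
          rcases i with _ | i
          · exact ⟨none, hi⟩
          · exact ⟨some i.succ, hi⟩
      · rintro ⟨i, hi⟩
        rcases i with _ | i
        · exact ((hS X).2 ⟨none, hi⟩).1
        · induction i using Fin.cases with
          | zero => exact hV hi
          | succ i => exact ((hS X).2 ⟨some i, hi⟩).1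
  · intro Z _
    funext o
    rcases o with _ | i
    · rfl
    · induction i using Fin.cases <;> rfl
  · rintro ⟨V, W⟩ _
    refine Sigma.ext rfl (heq_of_eq ?_)
    funext o
    rcases o with _ | i <;> rfl
  · intro Z _
    rw [Fin.prod_univ_succ]
    simp only [Option.map_none, Option.map_some, Fin.tail]
    ring

open Classical in
/-- The first Bernoulli component is either absent, or it is one of the elements of the set. -/
theorem pmbDensity_succ (lam : α → ℝ) (r : Fin (n + 1) → ℝ)
    (p : Fin (n + 1) → α → ℝ) (S : FinSets α) :
    pmbDensity μ lam r p S = (1 - r 0) * pmbDensity μ lam (Fin.tail r) (Fin.tail p) S +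
      ∑ X ∈ S.toFinset, r 0 * p 0 X *
        pmbDensity μ lam (Fin.tail r) (Fin.tail p) ⟨S.toFinset.erase X⟩ := by
  rw [pmbDensity_succ_eq_sum_powerset]
  have h1 : insert ∅ (S.toFinset.image fun X => ({X} : Finset α)) ⊆ S.toFinset.powerset := by
    intro V
    simp only [Finset.mem_insert, Finset.mem_image, Finset.mem_powerset]
    rintro (rfl | ⟨X, hX, rfl⟩)
    · simp
    · simpa using hX
  rw [← Finset.sum_subset h1, Finset.sum_insert (by simp), Finset.sum_image (by simp)]
  · simp [bernoulliDensity, Finset.sdiff_singleton_eq_erase]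
  · intro V hV hV'
    simp only [Finset.mem_insert, Finset.mem_image, not_or, not_exists, not_and,
      Finset.mem_powerset] at hV hV'
    have h0 : V.card ≠ 0 := fun h => hV'.1 (Finset.card_eq_zero.1 h)
    have h2 : V.card ≠ 1 := fun h => by
      obtain ⟨X, rfl⟩ := Finset.card_eq_one.1 h
      exact hV'.2 X (hV (by simp)) rfl
    simp [bernoulliDensity, h0, h2]

theorem pmbDensity_nonneg {lam : α → ℝ} {r : Fin n → ℝ} {p : Fin n → α → ℝ}
    (hlam : ∀ X, 0 ≤ lam X) (hr : ∀ i, 0 ≤ r i ∧ r i ≤ 1) (hp : ∀ i X, 0 ≤ p i X)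
    (S : FinSets α) : 0 ≤ pmbDensity μ lam r p S := by
  refine Finset.sum_nonneg fun Z _ => mul_nonneg
    (mul_nonneg (Real.exp_pos _).le (Finset.prod_nonneg fun X _ => hlam X))
    (Finset.prod_nonneg fun i _ => ?_)
  unfold bernoulliDensity
  split_ifs
  · linarith [(hr i).2]
  · exact mul_nonneg (hr i).1 (Finset.prod_nonneg fun X _ => hp i X)
  · exact le_rfl

end Combinatorics

/-! ### Measurability on the space of finite subsets -/

namespace FinSets

section Sets

variable {α : Type*}

theorem ext_mem {S T : FinSets α} (h : ∀ X, X ∈ S.toFinset ↔ X ∈ T.toFinset) : S = T :=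
  FinSets.ext (Finset.ext h)

@[simp]
theorem mem_ofTuple {n : ℕ} {x : Fin n → α} {X : α} :
    X ∈ (ofTuple x).toFinset ↔ ∃ i, x i = X := by
  simp [ofTuple]

open Classical in
/-- `S ∪ {X}` for `z = inl X`, and `S` itself for `z = inr ()`. -/
noncomputable def adjoin (S : FinSets α) (z : α ⊕ Unit) : FinSets α :=
  ⟨S.toFinset ∪ Sum.elim (fun X => {X}) (fun _ => ∅) z⟩

@[simp]
theorem mem_adjoin {S : FinSets α} {z : α ⊕ Unit} {X : α} :
    X ∈ (S.adjoin z).toFinset ↔ X ∈ S.toFinset ∨ z = Sum.inl X := by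
  rcases z with Y | _ <;> simp [adjoin, eq_comm, or_comm]

@[simp]
theorem adjoin_inr (S : FinSets α) (u : Unit) : S.adjoin (Sum.inr u) = S :=
  ext_mem fun X => by simp

open Classical in
/-- The union of `S` with all `{X}` such that `inl X` is an entry of the tuple `z`. -/
noncomputable def adjoinTuple (S : FinSets α) {m : ℕ} (z : Fin m → α ⊕ Unit) : FinSets α :=
  ⟨S.toFinset ∪ Finset.univ.biUnion fun i => Sum.elim (fun X => {X}) (fun _ => ∅) (z i)⟩

@[simp]
theorem mem_adjoinTuple {S : FinSets α} {m : ℕ} {z : Fin m → α ⊕ Unit} {X : α} :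
    X ∈ (S.adjoinTuple z).toFinset ↔ X ∈ S.toFinset ∨ ∃ i, z i = Sum.inl X := by
  simp only [adjoinTuple, Finset.mem_union, Finset.mem_biUnion, Finset.mem_univ, true_and]
  refine or_congr Iff.rfl (exists_congr fun i => ?_)
  rcases z i with Y | _ <;> simp [eq_comm]

theorem adjoinTuple_cons (S : FinSets α) {m : ℕ} (z : α ⊕ Unit) (w : Fin m → α ⊕ Unit) :
    S.adjoinTuple (Fin.cons z w : Fin (m + 1) → α ⊕ Unit) = (S.adjoin z).adjoinTuple w :=
  ext_mem fun X => by simp [Fin.exists_fin_succ, or_assoc]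

theorem adjoin_adjoinTuple (S : FinSets α) {m : ℕ} (z : α ⊕ Unit) (w : Fin m → α ⊕ Unit) :
    (S.adjoinTuple w).adjoin z = S.adjoinTuple (Fin.cons z w : Fin (m + 1) → α ⊕ Unit) :=
  ext_mem fun X => by simp [Fin.exists_fin_succ]; tauto

theorem adjoinTuple_zero (S : FinSets α) (z : Fin 0 → α ⊕ Unit) : S.adjoinTuple z = S :=
  ext_mem fun X => by simp

theorem ofTuple_adjoin {n : ℕ} (x : Fin n → α) (X : α) :
    (ofTuple x).adjoin (Sum.inl X) = ofTuple (Fin.cons X x : Fin (n + 1) → α) :=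
  ext_mem fun Y => by simp [Fin.exists_fin_succ, or_comm]

theorem exists_injective_ofTuple (S : FinSets α) :
    ∃ (n : ℕ) (x : Fin n → α), Function.Injective x ∧ S = ofTuple x := by
  refine ⟨S.toFinset.card, fun i => (S.toFinset.equivFin.symm i : α),
    Subtype.val_injective.comp (Equiv.injective _), ext_mem fun X => ?_⟩
  rw [mem_ofTuple]
  exact ⟨fun hX => ⟨S.toFinset.equivFin ⟨X, hX⟩, by simp⟩,
    fun ⟨i, hi⟩ => hi ▸ (S.toFinset.equivFin.symm i).2⟩

open Classical in
/-- The positions at which the entries of a tuple occur for the first time. -/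
noncomputable def firstOccurrences {n : ℕ} (x : Fin n → α) : Finset (Fin n) :=
  Finset.univ.filter fun i => ∀ j < i, x j ≠ x i

theorem mem_firstOccurrences {n : ℕ} {x : Fin n → α} {i : Fin n} :
    i ∈ firstOccurrences x ↔ ∀ j < i, x j ≠ x i := by
  simp [firstOccurrences]

theorem injective_comp_firstOccurrences {n : ℕ} (x : Fin n → α) :
    Function.Injective fun i => x ((firstOccurrences x).orderEmbOfFin rfl i) := by
  intro i j hij
  have key : ∀ i, _ := fun i =>
    mem_firstOccurrences.1 ((firstOccurrences x).orderEmbOfFin_mem rfl i)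
  rcases lt_trichotomy i j with h | h | h
  · exact absurd hij (key j _ (OrderEmbedding.lt_iff_lt _ |>.2 h))
  · exact h
  · exact absurd hij.symm (key i _ (OrderEmbedding.lt_iff_lt _ |>.2 h))

theorem ofTuple_comp_firstOccurrences {n : ℕ} (x : Fin n → α) :
    ofTuple (fun i => x ((firstOccurrences x).orderEmbOfFin rfl i)) = ofTuple x := by
  classical
  refine ext_mem fun X => ?_
  simp only [mem_ofTuple]
  constructor
  · rintro ⟨i, hi⟩
    exact ⟨_, hi⟩
  · rintro ⟨i, rfl⟩
    obtain ⟨j, hj, hmin⟩ := Finset.exists_minimal (s := Finset.univ.filter fun j => x j = x i)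
      ⟨i, by simp⟩
    simp only [Finset.mem_filter, Finset.mem_univ, true_and] at hj hmin
    have hmem : j ∈ firstOccurrences x := mem_firstOccurrences.2 fun l hl h =>
      absurd (hmin (h.trans hj) hl.le) (not_le.2 hl)
    rw [← Finset.mem_coe, ← Finset.range_orderEmbOfFin _ rfl] at hmem
    obtain ⟨l, hl⟩ := hmem
    exact ⟨l, by rw [hl, hj]⟩

end Sets

variable {α β γ : Type*} [MeasurableSpace α] [MeasurableSpace β] [MeasurableSpace γ]

theorem measurable_ofTuple (n : ℕ) : Measurable (ofTuple : (Fin n → α) → FinSets α) :=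
  fun _ hB => MeasurableSpace.measurableSet_iInf.1 hB n

theorem measurable_of_comp_ofTuple {f : FinSets α → γ}
    (h : ∀ n, Measurable fun x : Fin n → α => f (ofTuple x)) : Measurable f :=
  fun _ hB => MeasurableSpace.measurableSet_iInf.2 fun n => h n hB

/-- Measurability on `FinSets α` has to be checked on the tuples without repetitions only: any
other tuple has the same set of entries as its subtuple of first occurrences. -/
theorem measurable_of_injective_tuples [MeasurableEq α] {f : FinSets α → γ}
    (g : ∀ n, (Fin n → α) → γ) (hg : ∀ n, Measurable (g n))
    (h : ∀ n (x : Fin n → α), Function.Injective x → f (ofTuple x) = g n x) : Measurable f := by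
  refine measurable_of_comp_ofTuple fun n => ?_
  intro B hB
  have hset : (fun x : Fin n → α => f (ofTuple x)) ⁻¹' B =
      ⋃ s : Finset (Fin n), {x | ∀ i, i ∈ s ↔ ∀ j < i, x j ≠ x i} ∩
        (fun x : Fin n → α => g s.card fun i => x (s.orderEmbOfFin rfl i)) ⁻¹' B := by
    ext x
    simp only [Set.mem_preimage, Set.mem_iUnion, Set.mem_inter_iff, Set.mem_ofPred_eq]
    have key : f (ofTuple x) = g (firstOccurrences x).card
        fun i => x ((firstOccurrences x).orderEmbOfFin rfl i) := by
      rw [← h _ _ (injective_comp_firstOccurrences x), ofTuple_comp_firstOccurrences]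
    constructor
    · intro hx
      exact ⟨firstOccurrences x, fun i => mem_firstOccurrences, key ▸ hx⟩
    · rintro ⟨s, hs, hx⟩
      obtain rfl : s = firstOccurrences x :=
        Finset.ext fun i => (hs i).trans mem_firstOccurrences.symm
      exact key ▸ hx
  rw [hset]
  refine MeasurableSet.iUnion fun s => MeasurableSet.inter ?_ ?_
  · rw [measurableSet_setOfPred]
    fun_prop
  · exact ((hg _).comp (by fun_prop)) hB

theorem measurable_sum_prod {f : (α ⊕ β) × γ → FinSets α}
    (hl : Measurable fun q : α × γ => f (Sum.inl q.1, q.2))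
    (hr : Measurable fun q : β × γ => f (Sum.inr q.1, q.2)) : Measurable f := by
  have h : Measurable (f ∘ (MeasurableEquiv.sumProdDistrib α β γ).symm) :=
    measurable_fun_sum hl hr
  simpa [Function.comp_assoc] using h.comp (MeasurableEquiv.sumProdDistrib α β γ).measurable

theorem measurable_finCons {n : ℕ} {f : γ → α} {g : γ → Fin n → α} (hf : Measurable f)
    (hg : Measurable g) : Measurable fun c => (Fin.cons (f c) (g c) : Fin (n + 1) → α) := by
  refine measurable_pi_iff.2 fun i => ?_
  induction i using Fin.cases with
  | zero => simpa using hf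
  | succ i => simpa using measurable_pi_iff.1 hg i

theorem measurable_adjoinTuple (n m : ℕ) :
    Measurable fun q : (Fin n → α) × (Fin m → α ⊕ Unit) => (ofTuple q.1).adjoinTuple q.2 := by
  induction m generalizing n with
  | zero =>
    simp only [adjoinTuple_zero]
    exact (measurable_ofTuple n).comp measurable_fst
  | succ m ih =>
    have hl : Measurable fun q : α × ((Fin n → α) × (Fin m → α ⊕ Unit)) =>
        ((ofTuple q.2.1).adjoin (Sum.inl q.1)).adjoinTuple q.2.2 := by
      simp only [ofTuple_adjoin]
      have hq : Measurable fun q : α × ((Fin n → α) × (Fin m → α ⊕ Unit)) =>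
          ((Fin.cons q.1 q.2.1 : Fin (n + 1) → α), q.2.2) :=
        (measurable_finCons measurable_fst (measurable_fst.comp measurable_snd)).prodMk
          (measurable_snd.comp measurable_snd)
      have h3 := ih (n + 1)
      have h4 := h3.comp hq
      exact h4
    have hr : Measurable fun q : Unit × ((Fin n → α) × (Fin m → α ⊕ Unit)) =>
        ((ofTuple q.2.1).adjoin (Sum.inr q.1)).adjoinTuple q.2.2 := by
      simp only [adjoin_inr]
      exact (ih n).comp measurable_snd
    have h := measurable_sum_prod (f := fun q : (α ⊕ Unit) × ((Fin n → α) × (Fin m → α ⊕ Unit)) =>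
        ((ofTuple q.2.1).adjoin q.1).adjoinTuple q.2.2) hl hr
    have hq : Measurable fun q : (Fin n → α) × (Fin (m + 1) → α ⊕ Unit) =>
        (q.2 0, (q.1, fun i : Fin m => q.2 i.succ)) := by fun_prop
    have h2 := h.comp hq
    have heq : (fun q : (Fin n → α) × (Fin (m + 1) → α ⊕ Unit) =>
        (ofTuple q.1).adjoinTuple q.2) = fun q => ((ofTuple q.1).adjoin (q.2 0)).adjoinTuple
          fun i : Fin m => q.2 i.succ := by
      funext q
      rw [← adjoinTuple_cons]
      congr 1
      exact (Fin.cons_self_tail q.2).symm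
    rw [heq]
    exact h2

theorem measurable_adjoin (n : ℕ) :
    Measurable fun q : (Fin n → α) × (α ⊕ Unit) => (ofTuple q.1).adjoin q.2 := by
  have hq : Measurable fun q : (Fin n → α) × (α ⊕ Unit) => (q.1, fun _ : Fin 1 => q.2) := by
    fun_prop
  have h := (measurable_adjoinTuple (α := α) n 1).comp hq
  have heq : (fun q : (Fin n → α) × (α ⊕ Unit) => (ofTuple q.1).adjoin q.2) =
      fun q => (ofTuple q.1).adjoinTuple fun _ : Fin 1 => q.2 :=
    funext fun q => ext_mem fun X => by simp
  rw [heq]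
  exact h

theorem measurable_adjoin_left (S : FinSets α) : Measurable S.adjoin := by
  obtain ⟨n, x, -, rfl⟩ := S.exists_injective_ofTuple
  exact (measurable_adjoin n).comp (measurable_const.prodMk measurable_id)

end FinSets

/-! ### Tuples drawn from product measures -/

section Tuples

variable {α : Type*} [MeasurableSpace α]

theorem lintegral_pi_succ {m : ℕ} (μ : Fin (m + 1) → Measure α) [∀ i, SigmaFinite (μ i)]
    (i : Fin (m + 1)) {f : (Fin (m + 1) → α) → ℝ≥0∞} (hf : Measurable f) :
    ∫⁻ x, f x ∂(Measure.pi μ) =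
      ∫⁻ y, ∫⁻ a, f (i.insertNth a y) ∂(μ i) ∂(Measure.pi fun j => μ (i.succAbove j)) := by
  have h := ((measurePreserving_piFinSuccAbove μ i).symm).lintegral_comp hf
  rw [← h, lintegral_prod_symm]
  · simp [MeasurableEquiv.piFinSuccAbove_symm_apply, Fin.insertNthEquiv]
  · exact (hf.comp (MeasurableEquiv.measurable _)).aemeasurable

theorem ae_injective_pi [MeasurableEq α] (μ : Measure α) [SigmaFinite μ] [NullSingletonClass μ] (n : ℕ) :
    ∀ᵐ x ∂(Measure.pi fun _ : Fin n => μ), Function.Injective x := by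
  have h : ∀ i j : Fin n, i ≠ j → ∀ᵐ x ∂(Measure.pi fun _ : Fin n => μ), x i ≠ x j := by
    intro i j hij
    cases n with
    | zero => exact i.elim0
    | succ n =>
      obtain ⟨l, rfl⟩ := Fin.exists_succAbove_eq hij.symm
      rw [ae_iff]
      simp only [ne_eq, not_not]
      have hmeas : MeasurableSet {x : Fin (n + 1) → α | x i = x (i.succAbove l)} :=
        measurableSet_eq_fun (by fun_prop) (by fun_prop)
      rw [← lintegral_indicator_one hmeas, lintegral_pi_succ _ i (measurable_one.indicator hmeas)]
      refine (lintegral_congr fun y => ?_).trans lintegral_zero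
      refine (lintegral_congr_ae ?_).trans lintegral_zero
      filter_upwards [μ.ae_ne (y l)] with a ha
      simp [ha]
  have h2 : ∀ᵐ x ∂(Measure.pi fun _ : Fin n => μ), ∀ i j : Fin n, i ≠ j → x i ≠ x j := by
    simpa only [ae_all_iff, Filter.eventually_imp_distrib_left] using h
  filter_upwards [h2] with x hx i j hij
  by_contra hne
  exact hx i j hne hij

theorem lintegral_setMeasure (μ : Measure α) {f : FinSets α → ℝ≥0∞} (hf : Measurable f) :
    ∫⁻ S, f S ∂(setMeasure μ) = ∑' n : ℕ, (n.factorial : ℝ≥0∞)⁻¹ *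
      ∫⁻ x, f (FinSets.ofTuple x) ∂(Measure.pi fun _ : Fin n => μ) := by
  rw [setMeasure, lintegral_sum_measure]
  refine tsum_congr fun n => ?_
  rw [lintegral_smul_measure, lintegral_map hf (FinSets.measurable_ofTuple n), smul_eq_mul]

end Tuples

/-! ### Adjoining a random element as an operator on test functions -/

section Operators

variable (α : Type*) [MeasurableSpace α]

/-- The module of the measurable functions `FinSets α → ℝ≥0∞`. -/
def measurableFunctions : Submodule ℝ≥0∞ (FinSets α → ℝ≥0∞) where
  carrier := {ψ | Measurable ψ}
  add_mem' h₁ h₂ := Measurable.add h₁ h₂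
  zero_mem' := measurable_const
  smul_mem' c _ h := Measurable.const_mul h c

/-- A measurable function `FinSets α → ℝ≥0∞`. -/
abbrev TestFun : Type _ := measurableFunctions α

variable {α}

theorem TestFun.measurable (ψ : TestFun α) : Measurable ψ.1 := ψ.2

theorem TestFun.measurable_adjoinTuple (ψ : TestFun α) (n m : ℕ) :
    Measurable fun q : (Fin n → α) × (Fin m → α ⊕ Unit) =>
      ψ.1 ((FinSets.ofTuple q.1).adjoinTuple q.2) :=
  ψ.measurable.comp (FinSets.measurable_adjoinTuple n m)

theorem TestFun.measurable_adjoin (ψ : TestFun α) (S : FinSets α) :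
    Measurable fun z => ψ.1 (S.adjoin z) :=
  ψ.measurable.comp (FinSets.measurable_adjoin_left S)

theorem TestFun.measurable_adjoinTuple_left (ψ : TestFun α) (S : FinSets α) (m : ℕ) :
    Measurable fun z : Fin m → α ⊕ Unit => ψ.1 (S.adjoinTuple z) := by
  obtain ⟨n, x, -, rfl⟩ := S.exists_injective_ofTuple
  have hq : Measurable fun z : Fin m → α ⊕ Unit => (x, z) := measurable_const.prodMk measurable_id
  have h := (ψ.measurable_adjoinTuple n m).comp hq
  exact h

/-- The operator `ψ ↦ (S ↦ ∫ ψ(S ∪ z) a(dz))`, which adjoins to `S` a further element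
with law `a`; the point `inr ()` stands for no element at all. -/
noncomputable def adjoinOp (a : Measure (α ⊕ Unit)) [SFinite a] :
    Module.End ℝ≥0∞ (TestFun α) where
  toFun ψ := ⟨fun S => ∫⁻ z, ψ.1 (S.adjoin z) ∂a, by
    refine FinSets.measurable_of_comp_ofTuple fun n => ?_
    exact Measurable.lintegral_prod_right' (ν := a)
      (f := fun q : (Fin n → α) × (α ⊕ Unit) => ψ.1 ((FinSets.ofTuple q.1).adjoin q.2))
      (ψ.measurable.comp (FinSets.measurable_adjoin n))⟩
  map_add' ψ φ := Subtype.ext <| funext fun S =>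
    lintegral_add_left (ψ.measurable_adjoin S) _
  map_smul' c ψ := Subtype.ext <| funext fun S =>
    lintegral_const_mul c (ψ.measurable_adjoin S)

theorem adjoinOp_apply (a : Measure (α ⊕ Unit)) [SFinite a] (ψ : TestFun α) (S : FinSets α) :
    (adjoinOp a ψ).1 S = ∫⁻ z, ψ.1 (S.adjoin z) ∂a := rfl

theorem adjoinOp_congr {a b : Measure (α ⊕ Unit)} [SFinite a] [SFinite b] (h : a = b) :
    adjoinOp a = adjoinOp b := by
  subst h; rfl

theorem adjoinOp_add (a b : Measure (α ⊕ Unit)) [SFinite a] [SFinite b] :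
    adjoinOp (a + b) = adjoinOp a + adjoinOp b :=
  LinearMap.ext fun _ => Subtype.ext <| funext fun _ => lintegral_add_measure _ a b

/-- Adjoining no element, with weight `c`, is multiplication by `c`. -/
theorem adjoinOp_smul_dirac (c : ℝ≥0∞) (u : Unit)
    [SFinite (c • Measure.dirac (Sum.inr u : α ⊕ Unit))] :
    adjoinOp (c • Measure.dirac (Sum.inr u : α ⊕ Unit)) = c • 1 := by
  refine LinearMap.ext fun ψ => Subtype.ext <| funext fun S => ?_
  rw [adjoinOp_apply, lintegral_smul_measure, lintegral_dirac' _ (ψ.measurable_adjoin S),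
    FinSets.adjoin_inr]
  rfl

theorem adjoinOp_inl_apply (a : Measure α) [SFinite a] (ψ : TestFun α) (S : FinSets α) :
    (adjoinOp (a.map Sum.inl) ψ).1 S = ∫⁻ X, ψ.1 (S.adjoin (Sum.inl X)) ∂a := by
  rw [adjoinOp_apply, lintegral_map (ψ.measurable_adjoin S) measurable_inl]

theorem adjoinOp_commute (a b : Measure (α ⊕ Unit)) [SFinite a] [SFinite b] :
    Commute (adjoinOp a) (adjoinOp b) := by
  refine LinearMap.ext fun ψ => Subtype.ext <| funext fun S => ?_
  obtain ⟨n, x, -, rfl⟩ := S.exists_injective_ofTuple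
  change ∫⁻ z, ∫⁻ w, ψ.1 (((FinSets.ofTuple x).adjoin z).adjoin w) ∂b ∂a =
    ∫⁻ w, ∫⁻ z, ψ.1 (((FinSets.ofTuple x).adjoin w).adjoin z) ∂a ∂b
  refine (lintegral_lintegral_swap (Measurable.aemeasurable ?_)).trans
    (lintegral_congr fun w => lintegral_congr fun z => congrArg ψ.1
      (FinSets.ext_mem fun X => by simp only [FinSets.mem_adjoin]; tauto))
  have heq : (Function.uncurry fun z w => ψ.1 (((FinSets.ofTuple x).adjoin z).adjoin w)) =
      fun q => ψ.1 ((FinSets.ofTuple x).adjoinTuple ![q.1, q.2]) := by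
    funext q
    exact congrArg ψ.1 (FinSets.ext_mem fun X => by
      simp [Fin.exists_fin_two, or_assoc])
  rw [heq]
  have hq : Measurable fun q : (α ⊕ Unit) × (α ⊕ Unit) => ![q.1, q.2] := by
    refine measurable_pi_iff.2 fun i => ?_
    fin_cases i
    · exact measurable_fst
    · exact measurable_snd
  have h := (ψ.measurable_adjoinTuple_left (FinSets.ofTuple x) 2).comp hq
  exact h

/-- Adjoining a tuple with law `a^m` is adjoining `m` times a single element with law `a`. -/
theorem lintegral_pi_adjoinTuple (a : Measure α) [SigmaFinite a] (m : ℕ) (ψ : TestFun α)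
    (S : FinSets α) :
    ∫⁻ x, ψ.1 (S.adjoinTuple fun i => Sum.inl (x i)) ∂(Measure.pi fun _ : Fin m => a) =
      ((adjoinOp (a.map Sum.inl) ^ m) ψ).1 S := by
  obtain ⟨n, s, -, rfl⟩ := S.exists_injective_ofTuple
  induction m generalizing ψ with
  | zero => simp [FinSets.adjoinTuple_zero]
  | succ m ih =>
    have hmeas : Measurable fun x : Fin (m + 1) → α =>
        ψ.1 ((FinSets.ofTuple s).adjoinTuple fun i => Sum.inl (x i)) := by
      have hq : Measurable fun x : Fin (m + 1) → α => fun i => (Sum.inl (x i) : α ⊕ Unit) :=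
        measurable_pi_iff.2 fun i => measurable_inl.comp (measurable_pi_apply i)
      have h := (ψ.measurable_adjoinTuple_left (FinSets.ofTuple s) (m + 1)).comp hq
      exact h
    rw [lintegral_pi_succ (fun _ => a) 0 hmeas, pow_succ, Module.End.mul_apply, ← ih]
    refine lintegral_congr fun y => ?_
    rw [adjoinOp_inl_apply]
    refine lintegral_congr fun X => congrArg ψ.1 ?_
    refine FinSets.ext_mem fun Y => ?_
    simp [Fin.exists_fin_succ]
    tauto

/-- The sum `∑ₘ Aᵐ / m!`, applied to `ψ` and evaluated at the empty set. -/
noncomputable def expAtEmpty (A : Module.End ℝ≥0∞ (TestFun α)) (ψ : TestFun α) : ℝ≥0∞ :=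
  ∑' m : ℕ, (m.factorial : ℝ≥0∞)⁻¹ * ((A ^ m) ψ).1 ⟨∅⟩

theorem tsum_lintegral_pi_ofTuple (a : Measure α) [SigmaFinite a] (ψ : TestFun α) :
    ∑' m : ℕ, (m.factorial : ℝ≥0∞)⁻¹ *
      ∫⁻ x, ψ.1 (FinSets.ofTuple x) ∂(Measure.pi fun _ : Fin m => a) =
    expAtEmpty (adjoinOp (a.map Sum.inl)) ψ := by
  refine tsum_congr fun m => congrArg _ ?_
  rw [← lintegral_pi_adjoinTuple]
  exact lintegral_congr fun x => congrArg ψ.1 (FinSets.ext_mem fun X => by simp)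

/-- The functional equation of the exponential function. -/
theorem expAtEmpty_add {A B : Module.End ℝ≥0∞ (TestFun α)} (h : Commute A B) (ψ : TestFun α) :
    expAtEmpty (A + B) ψ =
      ∑' m : ℕ, (m.factorial : ℝ≥0∞)⁻¹ * expAtEmpty A ((B ^ m) ψ) := by
  have hR : ∑' m : ℕ, (m.factorial : ℝ≥0∞)⁻¹ * expAtEmpty A ((B ^ m) ψ) =
      ∑' q : ℕ × ℕ, (q.2.factorial : ℝ≥0∞)⁻¹ * ((q.1.factorial : ℝ≥0∞)⁻¹ *
        ((A ^ q.1 * B ^ q.2) ψ).1 ⟨∅⟩) := by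
    rw [ENNReal.tsum_prod (f := fun i j : ℕ => (j.factorial : ℝ≥0∞)⁻¹ *
      ((i.factorial : ℝ≥0∞)⁻¹ * ((A ^ i * B ^ j) ψ).1 ⟨∅⟩)), ENNReal.tsum_comm]
    refine tsum_congr fun m => ?_
    rw [expAtEmpty, ← ENNReal.tsum_mul_left]
    rfl
  rw [hR, ← (Finset.HasAntidiagonal.sigmaAntidiagonalEquivProd (A := ℕ)).tsum_eq, ENNReal.tsum_sigma', expAtEmpty]
  refine tsum_congr fun m => ?_
  rw [h.add_pow', tsum_fintype, ← Finset.sum_attach (Finset.HasAntidiagonal.antidiagonal m)]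
  simp only [LinearMap.sum_apply, Submodule.coe_sum, Finset.sum_apply, Finset.mul_sum,
    LinearMap.smul_apply, Finset.univ_eq_attach]
  refine Finset.sum_congr rfl fun q _ => ?_
  obtain ⟨⟨i, j⟩, hq⟩ := q
  have hq' : i + j = m := Finset.HasAntidiagonal.mem_antidiagonal.1 hq
  subst hq'
  change ((i + j).factorial : ℝ≥0∞)⁻¹ * ((i + j).choose i • ((A ^ i * B ^ j) ψ).1 ⟨∅⟩) =
    (j.factorial : ℝ≥0∞)⁻¹ * ((i.factorial : ℝ≥0∞)⁻¹ * ((A ^ i * B ^ j) ψ).1 ⟨∅⟩)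
  have h0 : ∀ n : ℕ, (n.factorial : ℝ≥0∞) ≠ 0 := fun n => by
    exact_mod_cast n.factorial_ne_zero
  have ht : ∀ n : ℕ, (n.factorial : ℝ≥0∞) ≠ ⊤ := fun n => ENNReal.natCast_ne_top _
  rw [nsmul_eq_mul, ← mul_assoc, ← mul_assoc, ← ENNReal.mul_inv (Or.inl (h0 j)) (Or.inl (ht j))]
  congr 1
  refine ENNReal.eq_inv_of_mul_eq_one_left ?_
  have hF : ((i + j).choose i : ℝ≥0∞) * (j.factorial * i.factorial) = (i + j).factorial := by
    rw [← Nat.add_choose_mul_factorial_mul_factorial i j, Nat.choose_symm_add]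
    push_cast
    ring
  rw [mul_assoc, hF, ENNReal.inv_mul_cancel (h0 _) (ht _)]

theorem tsum_inv_factorial_mul_pow {c : ℝ} (hc : 0 ≤ c) :
    ∑' m : ℕ, (m.factorial : ℝ≥0∞)⁻¹ * ENNReal.ofReal c ^ m = ENNReal.ofReal (Real.exp c) := by
  have h := NormedSpace.expSeries_div_hasSum_exp (𝔸 := ℝ) c
  rw [Real.exp_eq_exp_ℝ, ← h.tsum_eq, ENNReal.ofReal_tsum_of_nonneg (fun n => by positivity)
    h.summable]
  refine tsum_congr fun m => ?_
  rw [ENNReal.ofReal_div_of_pos (by positivity), ENNReal.ofReal_pow hc, ENNReal.ofReal_natCast,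
    mul_comm, div_eq_mul_inv]

/-- Adjoining a Poisson number of times no element at all, with mean `c`, only contributes the
factor `exp c`. -/
theorem expAtEmpty_add_smul_one (A : Module.End ℝ≥0∞ (TestFun α)) {c : ℝ} (hc : 0 ≤ c)
    (ψ : TestFun α) :
    expAtEmpty (A + ENNReal.ofReal c • 1) ψ = ENNReal.ofReal (Real.exp c) * expAtEmpty A ψ := by
  rw [expAtEmpty_add ((Commute.one_right A).smul_right _), ← tsum_inv_factorial_mul_pow hc,
    ← ENNReal.tsum_mul_right]
  refine tsum_congr fun m => ?_
  rw [smul_pow, one_pow, mul_assoc]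
  congr 1
  simp only [expAtEmpty, ← ENNReal.tsum_mul_left]
  refine tsum_congr fun l => ?_
  rw [LinearMap.smul_apply, Module.End.one_apply, map_smul]
  change (l.factorial : ℝ≥0∞)⁻¹ * (ENNReal.ofReal c ^ m * ((A ^ l) ψ).1 ⟨∅⟩) = _
  ring

end Operators

/-! ### Set integrals against PMB densities -/

section Densities

open Classical in
theorem sum_erase_ofTuple {α M : Type*} [AddCommMonoid M] {m : ℕ} {x : Fin (m + 1) → α}
    (hx : Function.Injective x) (G : α → FinSets α → M) :
    ∑ X ∈ (FinSets.ofTuple x).toFinset, G X ⟨(FinSets.ofTuple x).toFinset.erase X⟩ =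
      ∑ i, G (x i) (FinSets.ofTuple fun j => x (i.succAbove j)) := by
  have h : (FinSets.ofTuple x).toFinset = Finset.univ.image x := by
    ext X; simp
  conv_lhs => rw [Finset.sum_congr h fun _ _ => rfl]
  rw [Finset.sum_image fun i _ j _ hij => hx hij]
  refine Finset.sum_congr rfl fun i _ => congrArg _ (FinSets.ext_mem fun X => ?_)
  simp only [Finset.mem_erase, FinSets.mem_ofTuple]
  constructor
  · rintro ⟨h1, j, rfl⟩
    obtain ⟨l, rfl⟩ := Fin.exists_succAbove_eq (x := j) (y := i) fun h => h1 (h ▸ rfl)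
    exact ⟨l, rfl⟩
  · rintro ⟨l, rfl⟩
    exact ⟨fun h => Fin.succAbove_ne i l (hx h), _, rfl⟩

variable {α : Type*} [MeasurableSpace α]

theorem lintegral_pi_withDensity (μ : Measure α) [SigmaFinite μ] {c : α → ℝ≥0∞}
    (hc : Measurable c) [SigmaFinite (μ.withDensity c)] {m : ℕ} {f : (Fin m → α) → ℝ≥0∞}
    (hf : Measurable f) :
    ∫⁻ x, f x ∂(Measure.pi fun _ : Fin m => μ.withDensity c) =
      ∫⁻ x, (∏ i, c (x i)) * f x ∂(Measure.pi fun _ : Fin m => μ) := by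
  induction m with
  | zero =>
    rw [Measure.pi_of_empty (fun _ => μ.withDensity c), Measure.pi_of_empty fun _ => μ]
    simp
  | succ m ih =>
    have hins : Measurable fun q : α × (Fin m → α) =>
        (Fin.insertNth 0 q.1 q.2 : Fin (m + 1) → α) := by
      simp only [Fin.insertNth_zero']
      exact FinSets.measurable_finCons measurable_fst measurable_snd
    have hfi : ∀ y : Fin m → α, Measurable fun a : α => f (Fin.insertNth 0 a y) :=
      fun y => hf.comp (hins.comp (measurable_id.prodMk measurable_const))
    have hfs : Measurable fun y : Fin m → α => ∫⁻ a, f (Fin.insertNth 0 a y) ∂(μ.withDensity c) :=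
      Measurable.lintegral_prod_left' (f := fun q : α × (Fin m → α) => f (Fin.insertNth 0 q.1 q.2))
        (hf.comp hins)
    rw [lintegral_pi_succ _ 0 hf, ih hfs, lintegral_pi_succ _ 0 (by fun_prop)]
    refine lintegral_congr fun y => ?_
    rw [lintegral_withDensity_eq_lintegral_mul _ hc (hfi y),
      ← lintegral_const_mul _ (hc.mul (hfi y))]
    refine lintegral_congr fun a => ?_
    simp only [Pi.mul_apply, Fin.prod_univ_succ, Fin.insertNth_zero',
      Fin.cons_zero, Fin.cons_succ]
    ring

open Classical in
theorem measurable_sum_erase [MeasurableEq α] {M : Type*} [AddCommMonoid M] [MeasurableSpace M]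
    [MeasurableAdd₂ M] {G : α → FinSets α → M}
    (hG : ∀ m, Measurable fun q : α × (Fin m → α) => G q.1 (FinSets.ofTuple q.2)) :
    Measurable fun S : FinSets α => ∑ X ∈ S.toFinset, G X ⟨S.toFinset.erase X⟩ := by
  refine FinSets.measurable_of_injective_tuples (fun m => match m with
    | 0 => fun _ => 0
    | m + 1 => fun x => ∑ i, G (x i) (FinSets.ofTuple fun j => x (i.succAbove j))) ?_ ?_
  · rintro (_ | m)
    · exact measurable_const
    · refine Finset.measurable_sum _ fun i _ => ?_
      have hq : Measurable fun x : Fin (m + 1) → α => (x i, fun j => x (i.succAbove j)) := by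
        fun_prop
      exact (hG m).comp hq
  · rintro (_ | m) x hx
    · simp [FinSets.ofTuple]
    · exact sum_erase_ofTuple hx G

theorem measurable_poissonDensity [MeasurableEq α] {μ : Measure α} {lam : α → ℝ}
    (hlam : Measurable lam) :
    Measurable fun S : FinSets α => poissonDensity μ lam S.toFinset := by
  classical
  refine FinSets.measurable_of_injective_tuples
    (fun m x => Real.exp (-∫ X, lam X ∂μ) * ∏ i, lam (x i)) (fun m => by fun_prop) ?_
  intro m x hx
  have h : (FinSets.ofTuple x).toFinset = Finset.univ.image x := by
    ext X; simp
  rw [poissonDensity, h, Finset.prod_image fun i _ j _ hij => hx hij]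

theorem measurable_pmbDensity [MeasurableEq α] {μ : Measure α} {n : ℕ} {lam : α → ℝ}
    {r : Fin n → ℝ} {p : Fin n → α → ℝ} (hlam : Measurable lam) (hp : ∀ i, Measurable (p i)) :
    Measurable (pmbDensity μ lam r p) := by
  induction n with
  | zero =>
    simp only [funext (pmbDensity_zero lam r p)]
    exact measurable_poissonDensity hlam
  | succ n ih =>
    rw [funext (pmbDensity_succ lam r p)]
    have h := ih (r := Fin.tail r) (p := Fin.tail p) fun i => hp i.succ
    refine (h.const_mul _).add (measurable_sum_erase (G := fun X T =>
      r 0 * p 0 X * pmbDensity μ lam (Fin.tail r) (Fin.tail p) T) fun m => ?_)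
    exact ((((hp 0).comp measurable_fst).const_mul _)).mul
      ((h.comp (FinSets.measurable_ofTuple m)).comp measurable_snd)

open Classical in
/-- A set integral over the sets with one distinguished element is an integral over this element
and over the set of the other ones. -/
theorem lintegral_setMeasure_sum_erase [MeasurableEq α] (μ : Measure α) [SigmaFinite μ]
    [NullSingletonClass μ] {c : α → ℝ≥0∞} (hc : Measurable c) {f : FinSets α → ℝ≥0∞}
    (hf : Measurable f) (ψ : TestFun α) :
    ∫⁻ S, ψ.1 S * ∑ X ∈ S.toFinset, c X * f ⟨S.toFinset.erase X⟩ ∂(setMeasure μ) =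
      ∫⁻ S, (adjoinOp ((μ.withDensity c).map Sum.inl) ψ).1 S * f S ∂(setMeasure μ) := by
  have hfm : ∀ m, Measurable fun y : Fin m → α => f (FinSets.ofTuple y) := fun m =>
    hf.comp (FinSets.measurable_ofTuple m)
  have hψm : ∀ m, Measurable fun x : Fin m → α => ψ.1 (FinSets.ofTuple x) := fun m =>
    ψ.measurable.comp (FinSets.measurable_ofTuple m)
  have hsum := measurable_sum_erase (G := fun X T => c X * f T) fun m =>
    (hc.comp measurable_fst).mul ((hfm m).comp measurable_snd)
  have hL : Measurable fun S : FinSets α => ψ.1 S * ∑ X ∈ S.toFinset,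
      c X * f ⟨S.toFinset.erase X⟩ := ψ.measurable.mul hsum
  have hR : Measurable fun S =>
      (adjoinOp ((μ.withDensity c).map Sum.inl) ψ).1 S * f S := (TestFun.measurable _).mul hf
  rw [lintegral_setMeasure _ hL, lintegral_setMeasure _ hR, tsum_eq_zero_add' ENNReal.summable]
  have h0 : ∫⁻ x, ψ.1 (FinSets.ofTuple x) * ∑ X ∈ (FinSets.ofTuple x).toFinset,
      c X * f ⟨(FinSets.ofTuple x).toFinset.erase X⟩ ∂(Measure.pi fun _ : Fin 0 => μ) = 0 := by
    simp [FinSets.ofTuple]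
  rw [h0, mul_zero, zero_add]
  refine tsum_congr fun m => ?_
  set J := ∫⁻ y, (adjoinOp ((μ.withDensity c).map Sum.inl) ψ).1 (FinSets.ofTuple y) *
    f (FinSets.ofTuple y) ∂(Measure.pi fun _ : Fin m => μ) with hJ
  have hm : ∀ i : Fin (m + 1), Measurable fun x : Fin (m + 1) → α => ψ.1 (FinSets.ofTuple x) *
      (c (x i) * f (FinSets.ofTuple fun j => x (i.succAbove j))) := by
    intro i
    have hq : Measurable fun x : Fin (m + 1) → α => fun j => x (i.succAbove j) := by fun_prop
    exact (hψm _).mul ((hc.comp (measurable_pi_apply i)).mul ((hfm m).comp hq))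
  have key : ∀ i : Fin (m + 1), ∫⁻ x, ψ.1 (FinSets.ofTuple x) *
      (c (x i) * f (FinSets.ofTuple fun j => x (i.succAbove j)))
        ∂(Measure.pi fun _ : Fin (m + 1) => μ) = J := by
    intro i
    rw [lintegral_pi_succ _ i (hm i)]
    refine lintegral_congr fun y => ?_
    have hψa : Measurable fun a => ψ.1 ((FinSets.ofTuple y).adjoin (Sum.inl a)) :=
      (ψ.measurable_adjoin _).comp measurable_inl
    rw [adjoinOp_inl_apply, lintegral_withDensity_eq_lintegral_mul _ hc hψa,
      ← lintegral_mul_const _ (hc.mul hψa)]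
    refine lintegral_congr fun a => ?_
    have hset : FinSets.ofTuple (i.insertNth a y : Fin (m + 1) → α) =
        (FinSets.ofTuple y).adjoin (Sum.inl a) := FinSets.ext_mem fun X => by
      simp [Fin.exists_iff_succAbove i, or_comm]
    simp only [hset, Fin.insertNth_apply_same, Fin.insertNth_apply_succAbove, Pi.mul_apply]
    ring
  have hcongr : ∫⁻ x, ψ.1 (FinSets.ofTuple x) * ∑ X ∈ (FinSets.ofTuple x).toFinset,
      c X * f ⟨(FinSets.ofTuple x).toFinset.erase X⟩ ∂(Measure.pi fun _ : Fin (m + 1) => μ) =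
      ((m + 1 : ℕ) : ℝ≥0∞) * J := by
    have h1 : ∫⁻ x, ψ.1 (FinSets.ofTuple x) * ∑ X ∈ (FinSets.ofTuple x).toFinset,
        c X * f ⟨(FinSets.ofTuple x).toFinset.erase X⟩ ∂(Measure.pi fun _ : Fin (m + 1) => μ) =
        ∫⁻ x, ∑ i, ψ.1 (FinSets.ofTuple x) *
          (c (x i) * f (FinSets.ofTuple fun j => x (i.succAbove j)))
          ∂(Measure.pi fun _ : Fin (m + 1) => μ) := by
      refine lintegral_congr_ae ?_
      filter_upwards [ae_injective_pi μ (m + 1)] with x hx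
      rw [sum_erase_ofTuple hx fun X T => c X * f T, Finset.mul_sum]
    rw [h1, lintegral_finsetSum _ fun i _ => hm i, Finset.sum_congr rfl fun i _ => key i]
    simp
  rw [hcongr, ← mul_assoc]
  congr 1
  have h2 : ((m + 1 : ℕ) : ℝ≥0∞) ≠ 0 := by simp
  rw [Nat.factorial_succ, Nat.cast_mul, ENNReal.mul_inv (Or.inl h2)
    (Or.inl (ENNReal.natCast_ne_top _)), mul_right_comm, ENNReal.inv_mul_cancel h2
    (ENNReal.natCast_ne_top _), one_mul]

/-- The law of a Bernoulli random finite set: `inl X` stands for `{X}`, and `inr ()` for `∅`. -/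
noncomputable def bernoulliLaw (μ : Measure α) (r : ℝ) (p : α → ℝ) : Measure (α ⊕ Unit) :=
  (μ.withDensity fun X => ENNReal.ofReal (r * p X)).map Sum.inl +
    ENNReal.ofReal (1 - r) • Measure.dirac (Sum.inr ())

instance (μ : Measure α) [SFinite μ] (r : ℝ) (p : α → ℝ) : SFinite (bernoulliLaw μ r p) := by
  unfold bernoulliLaw
  infer_instance

/-- Without Bernoulli components, a PMB density is that of a Poisson process. -/
theorem lintegral_pmbDensity_zero [MeasurableEq α] (μ : Measure α) [SigmaFinite μ]
    [NullSingletonClass μ] {lam : α → ℝ} (hlam : IsIntensity μ lam) (r : Fin 0 → ℝ)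
    (p : Fin 0 → α → ℝ) (ψ : TestFun α) :
    ∫⁻ S, ψ.1 S * ENNReal.ofReal (pmbDensity μ lam r p S) ∂(setMeasure μ) =
      ENNReal.ofReal (Real.exp (-∫ X, lam X ∂μ)) * expAtEmpty
        (adjoinOp ((μ.withDensity fun X => ENNReal.ofReal (lam X)).map Sum.inl)) ψ := by
  classical
  have hfin : IsFiniteMeasure (μ.withDensity fun X => ENNReal.ofReal (lam X)) :=
    isFiniteMeasure_withDensity_ofReal hlam.integrable.2
  have hL : Measurable fun S => ψ.1 S * ENNReal.ofReal (pmbDensity μ lam r p S) :=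
    ψ.measurable.mul (measurable_pmbDensity hlam.measurable fun i => i.elim0).ennreal_ofReal
  rw [lintegral_setMeasure _ hL, ← tsum_lintegral_pi_ofTuple, ← ENNReal.tsum_mul_left]
  refine tsum_congr fun m => ?_
  have hψm : Measurable fun x : Fin m → α => ψ.1 (FinSets.ofTuple x) :=
    ψ.measurable.comp (FinSets.measurable_ofTuple m)
  rw [lintegral_pi_withDensity μ hlam.measurable.ennreal_ofReal hψm, mul_left_comm]
  congr 1
  rw [← lintegral_const_mul' _ _ ENNReal.ofReal_ne_top]
  refine lintegral_congr_ae ?_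
  filter_upwards [ae_injective_pi μ m] with x hx
  have h : (FinSets.ofTuple x).toFinset = Finset.univ.image x := by
    ext X; simp
  rw [pmbDensity_zero, poissonDensity, ENNReal.ofReal_mul (Real.exp_pos _).le, h,
    Finset.prod_image fun i _ j _ hij => hx hij,
    ENNReal.ofReal_prod_of_nonneg fun i _ => hlam.nonneg _]
  ring

/-- In a set integral, the first Bernoulli component can be replaced by its law, acting on the
test function. -/
theorem lintegral_pmbDensity_succ [MeasurableEq α] (μ : Measure α) [SigmaFinite μ]
    [NullSingletonClass μ] {n : ℕ} {lam : α → ℝ} {r : Fin (n + 1) → ℝ} {p : Fin (n + 1) → α → ℝ}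
    (hlam : IsIntensity μ lam) (hr : ∀ i, 0 ≤ r i ∧ r i ≤ 1) (hp : ∀ i, Measurable (p i))
    (hp0 : ∀ i X, 0 ≤ p i X) (ψ : TestFun α) :
    ∫⁻ S, ψ.1 S * ENNReal.ofReal (pmbDensity μ lam r p S) ∂(setMeasure μ) =
      ∫⁻ S, (adjoinOp (bernoulliLaw μ (r 0) (p 0)) ψ).1 S *
        ENNReal.ofReal (pmbDensity μ lam (Fin.tail r) (Fin.tail p) S) ∂(setMeasure μ) := by
  classical
  set f : FinSets α → ℝ≥0∞ := fun S =>
    ENNReal.ofReal (pmbDensity μ lam (Fin.tail r) (Fin.tail p) S) with hf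
  have hfm : Measurable f :=
    (measurable_pmbDensity hlam.measurable fun i => hp i.succ).ennreal_ofReal
  have hnn : ∀ S, 0 ≤ pmbDensity μ lam (Fin.tail r) (Fin.tail p) S :=
    pmbDensity_nonneg hlam.nonneg (fun i => hr i.succ) fun i => hp0 i.succ
  have hc : Measurable fun X => ENNReal.ofReal (r 0 * p 0 X) :=
    ((hp 0).const_mul _).ennreal_ofReal
  have hrec : ∀ S, ENNReal.ofReal (pmbDensity μ lam r p S) = ENNReal.ofReal (1 - r 0) * f S +
      ∑ X ∈ S.toFinset, ENNReal.ofReal (r 0 * p 0 X) * f ⟨S.toFinset.erase X⟩ := by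
    intro S
    have h1 : ∀ X, 0 ≤ r 0 * p 0 X := fun X => mul_nonneg (hr 0).1 (hp0 0 X)
    have h2 : 0 ≤ 1 - r 0 := by linarith [(hr 0).2]
    rw [pmbDensity_succ, ENNReal.ofReal_add (mul_nonneg h2 (hnn S))
      (Finset.sum_nonneg fun X _ => mul_nonneg (h1 X) (hnn _)), ENNReal.ofReal_mul h2,
      ENNReal.ofReal_sum_of_nonneg fun X _ => mul_nonneg (h1 X) (hnn _)]
    simp only [hf, ENNReal.ofReal_mul (h1 _)]
  have hb : adjoinOp (bernoulliLaw μ (r 0) (p 0)) =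
      adjoinOp ((μ.withDensity fun X => ENNReal.ofReal (r 0 * p 0 X)).map Sum.inl) +
        ENNReal.ofReal (1 - r 0) • 1 := by
    rw [← adjoinOp_smul_dirac (ENNReal.ofReal (1 - r 0)) (), ← adjoinOp_add]
    rfl
  simp only [hrec, mul_add]
  have h1 : Measurable fun S => ψ.1 S * (ENNReal.ofReal (1 - r 0) * f S) :=
    ψ.measurable.mul (hfm.const_mul _)
  rw [lintegral_add_left h1, lintegral_setMeasure_sum_erase μ hc hfm ψ, ← lintegral_add_left h1]
  refine lintegral_congr fun S => ?_
  rw [hb]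
  change _ = ((adjoinOp ((μ.withDensity fun X => ENNReal.ofReal (r 0 * p 0 X)).map Sum.inl) ψ).1 S
    + ENNReal.ofReal (1 - r 0) * ψ.1 S) * f S
  ring

end Densities

/-! ### The single-trajectory space -/

section SigmaType

variable {ι γ : Type*} {β : ι → Type*} [∀ i, MeasurableSpace (β i)] [MeasurableSpace γ]

theorem measurable_sigmaMk (i : ι) : Measurable (Sigma.mk i : β i → Sigma β) :=
  fun _ hB => MeasurableSpace.measurableSet_iInf.1 hB i

theorem measurable_of_sigma {f : Sigma β → γ} (h : ∀ i, Measurable fun x => f ⟨i, x⟩) :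
    Measurable f :=
  fun _ hB => MeasurableSpace.measurableSet_iInf.2 fun i => h i hB

end SigmaType

section Space

variable {d k : ℕ}

instance : Finite (TrajIndex k) := by
  refine Set.Finite.to_subtype (Set.Finite.subset
    ((Set.finite_Iic k).prod (Set.finite_Iic (k + 1))) ?_)
  rintro ⟨t, ν⟩ h
  have h1 : t ≤ k ∧ 1 ≤ ν ∧ ν ≤ k - t + 1 := h
  exact ⟨h1.1, show ν ≤ k + 1 by omega⟩

instance : MeasurableEq (Traj d k) := by
  classical
  -- the embedding that pads a trajectory with zeros in the components of the other indices
  let e : Traj d k → (TrajIndex k → Prop) × ((i : TrajIndex k) → Fin i.1.2 → State d) :=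
    fun X => (fun i => i = X.1, fun i => if h : X.1 = i then h ▸ X.2 else 0)
  have he : Measurable e := by
    refine measurable_of_sigma fun i => Measurable.prodMk
      (measurable_const : Measurable fun _ : Fin i.1.2 → State d => fun l : TrajIndex k => l = i)
      (measurable_pi_iff.2 fun j => ?_)
    by_cases h : i = j
    · subst h
      simpa using measurable_id'
    · simp only [h, dite_false]
      exact measurable_const
  have hinj : Function.Injective e := by
    rintro ⟨i, x⟩ ⟨j, y⟩ h
    obtain rfl : i = j := by
      have h1 := congrFun (congrArg Prod.fst h) i
      simpa [e] using h1
    have h2 := congrFun (congrArg Prod.snd h) i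
    simp only [e, dite_true] at h2
    rw [h2]
  constructor
  have h := measurableSet_eq_fun (he.comp measurable_fst) (he.comp (measurable_snd (α := Traj d k)))
  convert h using 1
  ext ⟨X, Y⟩
  simpa using hinj.eq_iff.symm

theorem lintegral_trajMeasure {f : Traj d k → ℝ≥0∞} (hf : Measurable f) :
    ∫⁻ X, f X ∂(trajMeasure d k) = ∑' i : TrajIndex k, ∫⁻ x, f ⟨i, x⟩ := by
  rw [trajMeasure, lintegral_sum_measure]
  exact tsum_congr fun i => lintegral_map hf (measurable_sigmaMk i)

theorem trajMeasure_apply {B : Set (Traj d k)} (hB : MeasurableSet B) :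
    trajMeasure d k B = ∑' i : TrajIndex k, volume (Sigma.mk i ⁻¹' B) := by
  rw [trajMeasure, Measure.sum_apply _ hB]
  exact tsum_congr fun i => Measure.map_apply (measurable_sigmaMk i) hB

instance : SigmaFinite (trajMeasure d k) := by
  refine ⟨⟨⟨fun n => {X : Traj d k | ‖X.2‖ ≤ n}, fun _ => trivial, ?_, ?_⟩⟩⟩
  · intro n
    have hB : MeasurableSet {X : Traj d k | ‖X.2‖ ≤ n} := by
      have h : Measurable fun X : Traj d k => ‖X.2‖ :=
        measurable_of_sigma fun i => measurable_norm
      exact measurableSet_le h measurable_const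
    have : Fintype (TrajIndex k) := Fintype.ofFinite _
    rw [trajMeasure_apply hB, tsum_fintype]
    refine ENNReal.sum_lt_top.2 fun i _ => ?_
    have h : (Sigma.mk i ⁻¹' {X : Traj d k | ‖X.2‖ ≤ n}) =
        Metric.closedBall (0 : Fin i.1.2 → State d) n := by
      ext x
      simp
    rw [h]
    exact measure_closedBall_lt_top
  · refine Set.eq_univ_of_forall fun X => ?_
    obtain ⟨n, hn⟩ := exists_nat_ge ‖X.2‖
    exact Set.mem_iUnion.2 ⟨n, hn⟩

theorem nullSingletonClass_trajMeasure (hd : 0 < d) : NullSingletonClass (trajMeasure d k) := by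
  refine ⟨fun X => ?_⟩
  rw [trajMeasure_apply (measurableSet_singleton X), ENNReal.tsum_eq_zero]
  intro i
  have : Nonempty (Fin d) := ⟨⟨0, hd⟩⟩
  have : Nonempty (Fin i.1.2) := ⟨⟨0, i.2.2.1⟩⟩
  have : NullSingletonClass (volume : Measure (State d)) := inferInstance
  refine Set.Subsingleton.measure_zero (fun x hx y hy => ?_) _
  have h : (⟨i, x⟩ : Traj d k) = ⟨i, y⟩ := hx.trans hy.symm
  simpa using h

end Space

section Maps

variable {d k : ℕ}

namespace Traj

theorem measurable_endTime : Measurable (endTime : Traj d k → ℕ) :=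
  measurable_of_sigma fun i =>
    (measurable_const : Measurable fun _ : Fin i.1.2 → State d => i.1.1 + i.1.2 - 1)

theorem measurable_start : Measurable (start : Traj d k → ℕ) :=
  measurable_of_sigma fun i => (measurable_const : Measurable fun _ : Fin i.1.2 → State d => i.1.1)

theorem measurable_len : Measurable (len : Traj d k → ℕ) :=
  measurable_of_sigma fun i => (measurable_const : Measurable fun _ : Fin i.1.2 → State d => i.1.2)

theorem measurable_last : Measurable (last : Traj d k → State d) :=
  measurable_of_sigma fun i => by
    change Measurable fun x : Fin i.1.2 → State d =>
      x ⟨i.1.2 - 1, by have h := i.2.2.1; omega⟩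
    exact measurable_pi_apply _

theorem measurable_keep : Measurable (keep : Traj d k → Traj d (k + 1)) :=
  measurable_of_sigma fun i => by
    unfold keep
    exact measurable_sigmaMk (β := fun j : TrajIndex (k + 1) => Fin j.1.2 → State d)
      ⟨i.1, by have h := i.2; omega⟩

theorem measurable_extend_mk (i : TrajIndex k) :
    Measurable fun q : (Fin i.1.2 → State d) × State d => extend (⟨i, q.1⟩ : Traj d k) q.2 := by
  have h : Measurable fun q : (Fin i.1.2 → State d) × State d =>
      (Fin.snoc (α := fun _ => State d) q.1 q.2 : Fin (i.1.2 + 1) → State d) := by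
    refine measurable_pi_iff.2 fun j => ?_
    induction j using Fin.lastCases with
    | last => simpa using measurable_snd
    | cast j => simp only [Fin.snoc_castSucc]; fun_prop
  exact (measurable_sigmaMk (β := fun j : TrajIndex (k + 1) => Fin j.1.2 → State d)
    ⟨(i.1.1, i.1.2 + 1), by have h := i.2; dsimp only; omega⟩).comp h

theorem measurable_extend (X : Traj d k) : Measurable X.extend :=
  (measurable_extend_mk X.1).comp (measurable_const.prodMk measurable_id)

theorem endTime_le (X : Traj d k) : X.endTime ≤ k := by
  have h := X.1.2
  simp only [endTime, start, len]
  omega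

theorem endTime_keep (X : Traj d k) : X.keep.endTime = X.endTime := rfl

theorem last_keep (X : Traj d k) : X.keep.last = X.last := rfl

theorem unkeep_keep (X : Traj d k) (h : X.keep.endTime ≤ k) : X.keep.unkeep h = X := rfl

theorem endTime_extend (X : Traj d k) (y : State d) : (X.extend y).endTime = X.endTime + 1 := by
  have h := X.1.2
  simp only [endTime, start, len, extend]
  omega

theorem two_le_len_extend (X : Traj d k) (y : State d) : 2 ≤ (X.extend y).len :=
  Nat.succ_le_succ X.1.2.2.1

theorem last_extend (X : Traj d k) (y : State d) : (X.extend y).last = y :=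
  Fin.snoc_last (α := fun _ => State d) (x := y) (p := X.2)

theorem trunc_extend (X : Traj d k) (y : State d) (h : 2 ≤ (X.extend y).len) :
    (X.extend y).trunc h = X := by
  obtain ⟨⟨⟨t, ν⟩, hi⟩, x⟩ := X
  refine Sigma.ext rfl (heq_of_eq (funext fun j => ?_))
  exact Fin.snoc_castSucc (α := fun _ => State d) (x := y) (p := x) (i := j)

theorem prevState_eq_last_trunc (Y : Traj d (k + 1)) (h : 2 ≤ Y.len) :
    prevState Y = (Y.trunc h).last := rfl

theorem prevState_extend (X : Traj d k) (y : State d) : prevState (X.extend y) = X.last := by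
  rw [prevState_eq_last_trunc _ (X.two_le_len_extend y), trunc_extend]

end Traj

theorem measurable_prevState : Measurable (prevState : Traj d k → State d) :=
  measurable_of_sigma fun i => by
    change Measurable fun x : Fin i.1.2 → State d =>
      x ⟨i.1.2 - 2, by have h := i.2.2.1; omega⟩
    exact measurable_pi_apply _

open Classical in
/-- The trajectories `X.keep` are those that end before the new time step. -/
theorem lintegral_keep {f : Traj d (k + 1) → ℝ≥0∞} (hf : Measurable f) :
    ∫⁻ X, f X.keep ∂(trajMeasure d k) =
      ∫⁻ Y, (if Y.endTime ≤ k then f Y else 0) ∂(trajMeasure d (k + 1)) := by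
  have hset : MeasurableSet {Y : Traj d (k + 1) | Y.endTime ≤ k} :=
    measurableSet_le Traj.measurable_endTime measurable_const
  rw [lintegral_trajMeasure (f := fun X => f X.keep) (hf.comp Traj.measurable_keep),
    lintegral_trajMeasure (Measurable.ite hset hf measurable_const)]
  let e : TrajIndex k → TrajIndex (k + 1) := fun i => ⟨i.1, by have h := i.2; omega⟩
  have he : Function.Injective e := fun i j h => Subtype.ext (congrArg (fun l => l.1) h)
  have h : ∀ i, ∫⁻ x, f (Traj.keep ⟨i, x⟩) = ∫⁻ x : Fin (e i).1.2 → State d,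
      (if Traj.endTime (⟨e i, x⟩ : Traj d (k + 1)) ≤ k then f ⟨e i, x⟩ else 0) := by
    intro i
    refine lintegral_congr fun x => ?_
    exact (if_pos (Traj.endTime_le (⟨i, x⟩ : Traj d k))).symm
  simp only [h]
  refine he.tsum_eq (f := fun j : TrajIndex (k + 1) => ∫⁻ x : Fin j.1.2 → State d,
    (if Traj.endTime (⟨j, x⟩ : Traj d (k + 1)) ≤ k then f ⟨j, x⟩ else 0)) ?_
  intro j hj
  by_contra hne
  refine hj ((lintegral_congr fun x => if_neg fun hle => hne ?_).trans lintegral_zero)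
  refine ⟨⟨j.1, ?_⟩, rfl⟩
  have h1 := j.2
  simp only [Traj.endTime, Traj.start, Traj.len] at hle
  omega

open Classical in
/-- The trajectories `X.extend y` are those of length at least two. -/
theorem lintegral_extend {f : Traj d (k + 1) → ℝ≥0∞} (hf : Measurable f) :
    ∫⁻ X, (∫⁻ y, f (Traj.extend X y)) ∂(trajMeasure d k) =
      ∫⁻ Y, (if 2 ≤ Y.len then f Y else 0) ∂(trajMeasure d (k + 1)) := by
  have hset : MeasurableSet {Y : Traj d (k + 1) | 2 ≤ Y.len} :=
    measurableSet_le measurable_const Traj.measurable_len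
  have hL : Measurable fun X : Traj d k => ∫⁻ y, f (X.extend y) :=
    measurable_of_sigma fun i => Measurable.lintegral_prod_right'
      (f := fun q : (Fin i.1.2 → State d) × State d => f (Traj.extend (⟨i, q.1⟩ : Traj d k) q.2))
      (hf.comp (Traj.measurable_extend_mk i))
  rw [lintegral_trajMeasure hL, lintegral_trajMeasure (Measurable.ite hset hf measurable_const)]
  let e : TrajIndex k → TrajIndex (k + 1) := fun i =>
    ⟨(i.1.1, i.1.2 + 1), by have h := i.2; dsimp only; omega⟩
  have he : Function.Injective e := fun i j h => by
    have h1 : (i.1.1, i.1.2 + 1) = (j.1.1, j.1.2 + 1) := congrArg (fun l => l.1) h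
    simp only [Prod.mk.injEq] at h1
    exact Subtype.ext (Prod.ext h1.1 (by omega))
  have h : ∀ i, ∫⁻ x : Fin i.1.2 → State d, ∫⁻ y, f (Traj.extend (⟨i, x⟩ : Traj d k) y) =
      ∫⁻ x : Fin (e i).1.2 → State d,
        (if 2 ≤ Traj.len (⟨e i, x⟩ : Traj d (k + 1)) then f ⟨e i, x⟩ else 0) := by
    intro i
    have hlen : ∀ x, 2 ≤ Traj.len (⟨e i, x⟩ : Traj d (k + 1)) := fun x =>
      Nat.succ_le_succ i.2.2.1
    simp only [hlen, if_true]
    refine Eq.symm ((lintegral_pi_succ (fun _ : Fin (i.1.2 + 1) => (volume : Measure (State d)))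
      (Fin.last _) (hf.comp (measurable_sigmaMk (e i)))).trans ?_)
    refine lintegral_congr fun x => lintegral_congr fun y => ?_
    simp only [Fin.insertNth_last', Function.comp_apply]
    rfl
  simp only [h]
  refine he.tsum_eq (f := fun j : TrajIndex (k + 1) => ∫⁻ x : Fin j.1.2 → State d,
    (if 2 ≤ Traj.len (⟨j, x⟩ : Traj d (k + 1)) then f ⟨j, x⟩ else 0)) ?_
  intro j hj
  by_contra hne
  refine hj ((lintegral_congr fun x => if_neg fun hle => hne ?_).trans lintegral_zero)
  have h1 := j.2
  simp only [Traj.len] at hle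
  refine ⟨⟨(j.1.1, j.1.2 - 1), by dsimp only; omega⟩, Subtype.ext (Prod.ext rfl ?_)⟩
  simp only [e]
  omega

end Maps

/-! ### The single-trajectory dynamics -/

theorem IsDensity.integrable {α : Type*} [MeasurableSpace α] {μ : Measure α} {p : α → ℝ}
    (hp : IsDensity μ p) : Integrable p μ := by
  by_contra h
  have h1 := hp.integral_eq_one
  rw [integral_undef h] at h1
  exact zero_ne_one h1

theorem IsDensity.lintegral_eq_one {α : Type*} [MeasurableSpace α] {μ : Measure α} {p : α → ℝ}
    (hp : IsDensity μ p) : ∫⁻ X, ENNReal.ofReal (p X) ∂μ = 1 := by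
  rw [← ofReal_integral_eq_lintegral_ofReal hp.integrable (Filter.Eventually.of_forall hp.nonneg),
    hp.integral_eq_one, ENNReal.ofReal_one]

section Dynamics

variable {d k : ℕ} (M : TargetModel d) (F : Formulation)

theorem survival_nonneg (X : Traj d k) : 0 ≤ survival M F X := by
  cases F
  · exact M.pS_nonneg _
  · exact zero_le_one

theorem survival_le_one (X : Traj d k) : survival M F X ≤ 1 := by
  cases F
  · exact M.pS_le_one _
  · exact le_rfl

theorem measurable_survival : Measurable (survival M F : Traj d k → ℝ) := by
  cases F
  · exact M.measurable_pS.comp Traj.measurable_last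
  · exact measurable_const

theorem measurable_g_left (x : State d) : Measurable fun y => M.g y x :=
  M.measurable_g.comp (measurable_id.prodMk measurable_const)

theorem lintegral_appendLaw (X : Traj d k) {f : Traj d (k + 1) → ℝ≥0∞} (hf : Measurable f) :
    ∫⁻ Y, f Y ∂(appendLaw M X) = ∫⁻ y, ENNReal.ofReal (M.g y X.last) * f (X.extend y) := by
  have hfX : Measurable fun y => f (X.extend y) := hf.comp X.measurable_extend
  rw [appendLaw, lintegral_map hf X.measurable_extend,
    lintegral_withDensity_eq_lintegral_mul _ (measurable_g_left M _).ennreal_ofReal hfX]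
  rfl

theorem measurable_appendLaw : Measurable (appendLaw M : Traj d k → Measure (Traj d (k + 1))) := by
  refine measurable_of_sigma fun i => Measure.measurable_of_measurable_coe _ fun B hB => ?_
  have h : ∀ x : Fin i.1.2 → State d, appendLaw M (⟨i, x⟩ : Traj d k) B =
      ∫⁻ y, ENNReal.ofReal (M.g y (Traj.last (⟨i, x⟩ : Traj d k))) *
        B.indicator 1 (Traj.extend (⟨i, x⟩ : Traj d k) y) := fun x => by
    rw [← lintegral_indicator_one hB, lintegral_appendLaw M _ (measurable_one.indicator hB)]
  simp only [h]
  have hlast : Measurable fun x : Fin i.1.2 → State d => Traj.last (⟨i, x⟩ : Traj d k) :=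
    Traj.measurable_last.comp (measurable_sigmaMk i)
  refine Measurable.lintegral_prod_right' (f := fun q : (Fin i.1.2 → State d) × State d =>
    ENNReal.ofReal (M.g q.2 (Traj.last (⟨i, q.1⟩ : Traj d k))) *
      B.indicator 1 (Traj.extend (⟨i, q.1⟩ : Traj d k) q.2)) (Measurable.mul ?_ ?_)
  · exact (M.measurable_g.comp
      (measurable_snd.prodMk (hlast.comp measurable_fst))).ennreal_ofReal
  · exact (measurable_one.indicator hB).comp (Traj.measurable_extend_mk i)

instance (X : Traj d k) : IsProbabilityMeasure (appendLaw M X) := by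
  refine ⟨?_⟩
  rw [← lintegral_one, lintegral_appendLaw M X measurable_const]
  simpa using (M.isDensity_g X.last).lintegral_eq_one

theorem ofReal_add_one_sub {s : ℝ} (h0 : 0 ≤ s) (h1 : s ≤ 1) :
    ENNReal.ofReal s + ENNReal.ofReal (1 - s) = 1 := by
  rw [← ENNReal.ofReal_add h0 (by linarith)]
  simp

instance (X : Traj d k) : IsProbabilityMeasure (transition M F X) := by
  cases F
  · exact inferInstanceAs (IsProbabilityMeasure (appendLaw M X))
  · unfold transition
    dsimp only
    split_ifs
    · refine ⟨?_⟩
      simp only [Measure.coe_add, Measure.coe_smul, Pi.add_apply, Pi.smul_apply, measure_univ,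
        smul_eq_mul, mul_one]
      rw [add_comm]
      exact ofReal_add_one_sub (M.pS_nonneg _) (M.pS_le_one _)
    · infer_instance

instance (X : Traj d k) : IsProbabilityMeasure (fateLaw M F X) := by
  refine ⟨?_⟩
  have : IsProbabilityMeasure
      ((transition M F X).map (Sum.inl : Traj d (k + 1) → Traj d (k + 1) ⊕ Unit)) :=
    Measure.isProbabilityMeasure_map measurable_inl.aemeasurable
  simp only [fateLaw, Measure.coe_add, Measure.coe_smul, Pi.add_apply, Pi.smul_apply, measure_univ,
        smul_eq_mul, mul_one]
  exact ofReal_add_one_sub (survival_nonneg M F X) (survival_le_one M F X)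

theorem measurable_transition :
    Measurable (transition M F : Traj d k → Measure (Traj d (k + 1))) := by
  classical
  cases F
  · exact measurable_appendLaw M
  · have hset : MeasurableSet {X : Traj d k | X.endTime = k} :=
      measurableSet_eq_fun Traj.measurable_endTime measurable_const
    have hp : Measurable fun X : Traj d k => M.pS X.last :=
      M.measurable_pS.comp Traj.measurable_last
    have hk : Measurable fun X : Traj d k => Measure.dirac X.keep :=
      Measure.measurable_dirac.comp Traj.measurable_keep
    refine Measurable.ite hset ?_ hk
    refine Measure.measurable_of_measurable_coe _ fun B hB => ?_
    simp only [Measure.coe_add, Measure.coe_smul, Pi.add_apply, Pi.smul_apply, smul_eq_mul]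
    exact ((measurable_const.sub hp).ennreal_ofReal.mul ((Measure.measurable_coe hB).comp hk)).add
      (hp.ennreal_ofReal.mul ((Measure.measurable_coe hB).comp (measurable_appendLaw M)))

theorem lintegral_fateLaw (X : Traj d k) {f : Traj d (k + 1) ⊕ Unit → ℝ≥0∞} (hf : Measurable f) :
    ∫⁻ z, f z ∂(fateLaw M F X) =
      ENNReal.ofReal (survival M F X) * ∫⁻ Y, f (Sum.inl Y) ∂(transition M F X) +
        ENNReal.ofReal (1 - survival M F X) * f (Sum.inr ()) := by
  rw [fateLaw, lintegral_add_measure, lintegral_smul_measure, lintegral_smul_measure,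
    lintegral_map hf measurable_inl, lintegral_dirac' _ hf]
  rfl

theorem measurable_fateLaw :
    Measurable (fateLaw M F : Traj d k → Measure (Traj d (k + 1) ⊕ Unit)) := by
  refine Measure.measurable_of_measurable_coe _ fun B hB => ?_
  have h : ∀ X : Traj d k, fateLaw M F X B = ENNReal.ofReal (survival M F X) *
      transition M F X (Sum.inl ⁻¹' B) +
        ENNReal.ofReal (1 - survival M F X) * B.indicator 1 (Sum.inr ()) := fun X => by
    rw [← lintegral_indicator_one hB, lintegral_fateLaw M F X (measurable_one.indicator hB),
      ← lintegral_indicator_one (measurable_inl hB)]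
    rfl
  simp only [h]
  exact ((measurable_survival M F).ennreal_ofReal.mul ((Measure.measurable_coe
    (measurable_inl hB)).comp (measurable_transition M F))).add
    ((measurable_const.sub (measurable_survival M F)).ennreal_ofReal.mul measurable_const)

/-! ### The pairings with the transition density -/

theorem integral_truncDirac_of_two_le (f : Traj d k → ℝ) (Y : Traj d (k + 1)) (h : 2 ≤ Y.len) :
    ∫ X, f X ∂(truncDirac Y) = f (Y.trunc h) := by
  rw [truncDirac, dif_pos h, integral_dirac]

theorem integral_truncDirac_of_lt (f : Traj d k → ℝ) (Y : Traj d (k + 1)) (h : ¬ 2 ≤ Y.len) :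
    ∫ X, f X ∂(truncDirac Y) = 0 := by
  rw [truncDirac, dif_neg h, integral_zero_measure]

/-- A trajectory of length one that exists at the new time step has no predecessor. -/
theorem transitionPairing_of_len_lt (a : Traj d k → ℝ) (Y : Traj d (k + 1)) (h : ¬ 2 ≤ Y.len)
    (h2 : F = .all → ¬ Y.endTime ≤ k) : transitionPairing M F a Y = 0 := by
  cases F
  · simp [transitionPairing, transitionAt, integral_truncDirac_of_lt _ Y h]
  · simp [transitionPairing, transitionAt, integral_truncDirac_of_lt _ Y h, h2 rfl]

theorem transitionPairing_alive_extend (a : Traj d k → ℝ) (X : Traj d k) (y : State d) :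
    transitionPairing M .alive a (X.extend y) = M.g y X.last * (a X * M.pS X.last) := by
  simp only [transitionPairing, transitionAt, survival, integral_smul_measure,
    integral_truncDirac_of_two_le _ _ (X.two_le_len_extend y), Traj.trunc_extend,
    Traj.last_extend, Traj.prevState_extend]
  rw [ENNReal.toReal_ofReal ((M.isDensity_g _).nonneg _), smul_eq_mul]

theorem transitionPairing_all_extend (a : Traj d k → ℝ) (X : Traj d k) (y : State d)
    (h : X.endTime = k) :
    transitionPairing M .all a (X.extend y) = M.pS X.last * M.g y X.last * a X := by
  have h2 : ¬ (X.extend y).endTime ≤ k := by rw [Traj.endTime_extend]; omega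
  simp only [transitionPairing, transitionAt, survival, dif_neg h2, integral_smul_measure,
    integral_truncDirac_of_two_le _ _ (X.two_le_len_extend y), Traj.trunc_extend,
    Traj.last_extend, Traj.prevState_extend, mul_one]
  rw [ENNReal.toReal_ofReal (mul_nonneg (M.pS_nonneg _) ((M.isDensity_g _).nonneg _)), smul_eq_mul]

theorem transitionPairing_all_of_endTime_lt (a : Traj d k → ℝ) (Y : Traj d (k + 1))
    (h : Y.endTime ≤ k) (h' : Y.endTime < k) :
    transitionPairing M .all a Y = a (Y.unkeep h) := by
  simp [transitionPairing, transitionAt, survival, h, h']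

theorem transitionPairing_all_of_endTime_eq (a : Traj d k → ℝ) (Y : Traj d (k + 1))
    (h : Y.endTime ≤ k) (h' : ¬ Y.endTime < k) :
    transitionPairing M .all a Y = (1 - M.pS Y.last) * a (Y.unkeep h) := by
  simp only [transitionPairing, transitionAt, survival, dif_pos h, if_neg h',
    integral_smul_measure, integral_dirac, mul_one]
  rw [ENNReal.toReal_ofReal (by linarith [M.pS_le_one Y.last]), smul_eq_mul]

theorem transitionPairing_nonneg {a : Traj d k → ℝ} (ha : ∀ X, 0 ≤ a X) (Y : Traj d (k + 1)) :
    0 ≤ transitionPairing M F a Y :=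
  integral_nonneg fun X => mul_nonneg (ha X) (survival_nonneg M F X)

theorem measurable_transitionPairing {a : Traj d k → ℝ} (ha : Measurable a) :
    Measurable (transitionPairing M F a) := by
  refine measurable_of_sigma fun j => ?_
  have hlast : Measurable fun x => Traj.last (⟨j, x⟩ : Traj d (k + 1)) :=
    Traj.measurable_last.comp (measurable_sigmaMk j)
  have hprev : Measurable fun x => prevState (⟨j, x⟩ : Traj d (k + 1)) :=
    measurable_prevState.comp (measurable_sigmaMk j)
  have hg : Measurable fun x => M.g (Traj.last (⟨j, x⟩ : Traj d (k + 1)))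
      (prevState (⟨j, x⟩ : Traj d (k + 1))) := M.measurable_g.comp (hlast.prodMk hprev)
  have htrunc : ∀ (h : 2 ≤ j.1.2) (f : Traj d k → ℝ), Measurable f → Measurable fun x =>
      f (Traj.trunc (⟨j, x⟩ : Traj d (k + 1)) h) := by
    intro h f hf
    refine hf.comp ?_
    have hx : Measurable fun x : Fin j.1.2 → State d => fun i : Fin (j.1.2 - 1) =>
        x ⟨i.1, by have h2 := i.2; omega⟩ := by fun_prop
    exact (measurable_sigmaMk (β := fun i : TrajIndex k => Fin i.1.2 → State d)
      ⟨(j.1.1, j.1.2 - 1), by have h1 := j.2; dsimp only; omega⟩).comp hx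
  have hdirac : ∀ f : Traj d k → ℝ, Measurable f → Measurable fun x =>
      ∫ X, f X ∂(truncDirac (⟨j, x⟩ : Traj d (k + 1))) := by
    intro f hf
    by_cases h : 2 ≤ j.1.2
    · simp only [fun x => integral_truncDirac_of_two_le f (⟨j, x⟩ : Traj d (k + 1)) h]
      exact htrunc h f hf
    · simp only [fun x => integral_truncDirac_of_lt f (⟨j, x⟩ : Traj d (k + 1)) h]
      exact measurable_const
  have hs : Measurable fun X => a X * survival M F X := ha.mul (measurable_survival M F)
  cases F
  · simp only [transitionPairing, transitionAt, integral_smul_measure, smul_eq_mul]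
    exact hg.ennreal_ofReal.ennreal_toReal.mul (hdirac _ hs)
  · by_cases h : j.1.1 + j.1.2 - 1 ≤ k
    · have hunkeep : Measurable fun x => a (Traj.unkeep (⟨j, x⟩ : Traj d (k + 1)) h) :=
        ha.comp (measurable_sigmaMk (β := fun i : TrajIndex k => Fin i.1.2 → State d)
          ⟨j.1, by have h1 := j.2; omega⟩)
      by_cases h' : j.1.1 + j.1.2 - 1 < k
      · simp only [fun x =>
          transitionPairing_all_of_endTime_lt M a (⟨j, x⟩ : Traj d (k + 1)) h h']
        exact hunkeep
      · simp only [fun x =>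
          transitionPairing_all_of_endTime_eq M a (⟨j, x⟩ : Traj d (k + 1)) h h']
        exact (measurable_const.sub (M.measurable_pS.comp hlast)).mul hunkeep
    · have h1 : ∀ x, ¬ Traj.endTime (⟨j, x⟩ : Traj d (k + 1)) ≤ k := fun _ => h
      simp only [transitionPairing, transitionAt, dif_neg (h1 _), integral_smul_measure,
        smul_eq_mul]
      exact ((M.measurable_pS.comp hprev).mul hg).ennreal_ofReal.ennreal_toReal.mul (hdirac _ hs)

/-- The measure `∫ a(X) p^S(X) g(· | X) dX` has the density `⟨a, g(Y | ·) p^S(·)⟩`. -/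
theorem lintegral_transition {a : Traj d k → ℝ} (ha : Measurable a) (ha0 : ∀ X, 0 ≤ a X)
    {f : Traj d (k + 1) → ℝ≥0∞} (hf : Measurable f) :
    ∫⁻ X, ENNReal.ofReal (a X) * (ENNReal.ofReal (survival M F X) *
        ∫⁻ Y, f Y ∂(transition M F X)) ∂(trajMeasure d k) =
      ∫⁻ Y, ENNReal.ofReal (transitionPairing M F a Y) * f Y ∂(trajMeasure d (k + 1)) := by
  classical
  set h : Traj d (k + 1) → ℝ≥0∞ := fun Y => ENNReal.ofReal (transitionPairing M F a Y) * f Y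
    with hh
  have hhm : Measurable h := (measurable_transitionPairing M F ha).ennreal_ofReal.mul hf
  have hext : ∀ X : Traj d k, Measurable fun y =>
      ENNReal.ofReal (M.g y X.last) * f (X.extend y) := fun X =>
    (measurable_g_left M _).ennreal_ofReal.mul (hf.comp X.measurable_extend)
  cases F
  · calc _ = ∫⁻ X, (∫⁻ y, h (Traj.extend X y)) ∂(trajMeasure d k) := by
          refine lintegral_congr fun X => ?_
          simp only [transition, survival, lintegral_appendLaw M X hf]
          rw [← mul_assoc, ← ENNReal.ofReal_mul (ha0 X), ← lintegral_const_mul _ (hext X)]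
          refine lintegral_congr fun y => ?_
          simp only [hh, transitionPairing_alive_extend]
          rw [ENNReal.ofReal_mul ((M.isDensity_g _).nonneg _)]
          ring
      _ = ∫⁻ Y, (if 2 ≤ Y.len then h Y else 0) ∂(trajMeasure d (k + 1)) := lintegral_extend hhm
      _ = ∫⁻ Y, h Y ∂(trajMeasure d (k + 1)) := by
          refine lintegral_congr fun Y => ?_
          split_ifs with hY
          · rfl
          · simp [hh, transitionPairing_of_len_lt M .alive a Y hY (by simp)]
  · have hset : MeasurableSet {Y : Traj d (k + 1) | Y.endTime ≤ k} :=
      measurableSet_le Traj.measurable_endTime measurable_const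
    have hm1 : Measurable fun Y => if Y.endTime ≤ k then h Y else 0 :=
      Measurable.ite hset hhm measurable_const
    have hm2 : Measurable fun Y => if Y.endTime ≤ k then 0 else h Y :=
      Measurable.ite hset measurable_const hhm
    calc _ = ∫⁻ X, (h (Traj.keep X) + ∫⁻ y, (if (Traj.extend X y).endTime ≤ k then 0 else
            h (Traj.extend X y))) ∂(trajMeasure d k) := by
          refine lintegral_congr fun X => ?_
          simp only [transition, survival, ENNReal.ofReal_one, one_mul]
          by_cases hX : X.endTime = k
          · have h1 : ∀ y, ¬ (X.extend y).endTime ≤ k := fun y => by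
              rw [Traj.endTime_extend]; omega
            simp only [if_pos hX, h1, if_false]
            rw [lintegral_add_measure, lintegral_smul_measure, lintegral_smul_measure,
              lintegral_dirac' _ hf, lintegral_appendLaw M X hf, smul_eq_mul, smul_eq_mul, mul_add]
            congr 1
            · simp only [hh]
              rw [transitionPairing_all_of_endTime_eq M a X.keep
                (by rw [Traj.endTime_keep]; exact hX.le) (by rw [Traj.endTime_keep]; omega),
                ENNReal.ofReal_mul (by linarith [M.pS_le_one X.keep.last]), Traj.unkeep_keep,
                Traj.last_keep]
              ring
            · rw [← mul_assoc, ← lintegral_const_mul _ (hext X)]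
              refine lintegral_congr fun y => ?_
              simp only [hh, transitionPairing_all_extend M a X y hX]
              rw [ENNReal.ofReal_mul (mul_nonneg (M.pS_nonneg _) ((M.isDensity_g _).nonneg _)),
                ENNReal.ofReal_mul (M.pS_nonneg _)]
              ring
          · have hlt : X.endTime < k := lt_of_le_of_ne X.endTime_le hX
            have h1 : ∀ y, (X.extend y).endTime ≤ k := fun y => by
              rw [Traj.endTime_extend]; omega
            simp only [if_neg hX, h1, if_true, lintegral_zero, add_zero]
            rw [lintegral_dirac' _ hf]
            simp only [hh]
            rw [transitionPairing_all_of_endTime_lt M a X.keep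
              (by rw [Traj.endTime_keep]; exact hlt.le) (by rw [Traj.endTime_keep]; exact hlt),
              Traj.unkeep_keep]
      _ = ∫⁻ Y, ((if Y.endTime ≤ k then h Y else 0) +
            if 2 ≤ Y.len then (if Y.endTime ≤ k then 0 else h Y) else 0)
            ∂(trajMeasure d (k + 1)) := by
          have hk : Measurable fun X : Traj d k => h X.keep := hhm.comp Traj.measurable_keep
          rw [lintegral_add_left hk, lintegral_keep hhm,
            lintegral_extend hm2, ← lintegral_add_left hm1]
      _ = ∫⁻ Y, h Y ∂(trajMeasure d (k + 1)) := by
          refine lintegral_congr fun Y => ?_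
          by_cases h1 : Y.endTime ≤ k
          · simp [h1]
          · by_cases h2 : 2 ≤ Y.len
            · simp [h1, h2]
            · simp [h1, h2, hh, transitionPairing_of_len_lt M .all a Y h2 fun _ => h1]

end Dynamics

/-! ### The Markov transition of the set of trajectories -/

section Birth

variable {d : ℕ} (M : TargetModel d) (k : ℕ)

theorem isIntensity_birthIntensity : IsIntensity (trajMeasure d k) (birthIntensity M k) := by
  classical
  have hm : Measurable (birthIntensity M k : Traj d k → ℝ) := by
    have hset : MeasurableSet {X : Traj d k | X.start = k ∧ X.len = 1} :=
      (measurableSet_eq_fun Traj.measurable_start measurable_const).inter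
        (measurableSet_eq_fun Traj.measurable_len measurable_const)
    exact Measurable.ite hset (M.isIntensity_birth.measurable.comp Traj.measurable_last)
      measurable_const
  have h0 : ∀ X : Traj d k, 0 ≤ birthIntensity M k X := fun X => by
    unfold birthIntensity
    split_ifs
    · exact M.isIntensity_birth.nonneg _
    · exact le_rfl
  refine ⟨hm, h0, hm.aestronglyMeasurable, ?_⟩
  rw [hasFiniteIntegral_iff_ofReal (Filter.Eventually.of_forall h0),
    lintegral_trajMeasure hm.ennreal_ofReal]
  have : Fintype (TrajIndex k) := Fintype.ofFinite _
  rw [tsum_fintype]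
  refine ENNReal.sum_lt_top.2 fun i _ => ?_
  by_cases hi : i.1.1 = k ∧ i.1.2 = 1
  · obtain ⟨⟨t, ν⟩, h⟩ := i
    obtain ⟨-, h1⟩ := hi
    dsimp only at h1
    subst h1
    have hx : ∀ x : Fin 1 → State d,
        ENNReal.ofReal (birthIntensity M k (⟨⟨(t, 1), h⟩, x⟩ : Traj d k)) ≤
          ENNReal.ofReal (M.birth (x 0)) := fun x => by
      refine ENNReal.ofReal_le_ofReal ?_
      unfold birthIntensity
      split_ifs
      · exact le_rfl
      · exact M.isIntensity_birth.nonneg _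
    refine (lintegral_mono hx).trans_lt ?_
    have hb : Measurable fun x : Fin 1 → State d => ENNReal.ofReal (M.birth (x 0)) :=
      (M.isIntensity_birth.measurable.comp (measurable_pi_apply 0)).ennreal_ofReal
    refine (lintegral_pi_succ (fun _ : Fin 1 => (volume : Measure (State d))) 0 hb).trans_lt ?_
    simp only [Fin.insertNth_apply_same, lintegral_const]
    have h2 := M.isIntensity_birth.integrable.2
    rw [hasFiniteIntegral_iff_ofReal (Filter.Eventually.of_forall M.isIntensity_birth.nonneg)] at h2
    exact ENNReal.mul_lt_top h2 (measure_lt_top _ _)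
  · have hz : ∀ x, birthIntensity M k (⟨i, x⟩ : Traj d k) = 0 := fun x => if_neg hi
    simp [hz]

/-- The intensity measure of the new born trajectories. -/
noncomputable def birthMeasure : Measure (Traj d k) :=
  (trajMeasure d k).withDensity fun X => ENNReal.ofReal (birthIntensity M k X)

instance : IsFiniteMeasure (birthMeasure M k) :=
  isFiniteMeasure_withDensity_ofReal (isIntensity_birthIntensity M k).integrable.2

instance : SFinite ((birthMeasure M k).map (Sum.inl : Traj d k → Traj d k ⊕ Unit)) :=
  inferInstance

end Birth

section MultiTransition

variable {d k : ℕ} (M : TargetModel d) (F : Formulation)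

/-- The law of the fates `z` of the trajectories of a tuple `x`, together with `l` new born
trajectories `y`. -/
noncomputable def fatesLaw {m : ℕ} (x : Fin m → Traj d k) (l : ℕ) :
    Measure ((Fin m → Traj d (k + 1) ⊕ Unit) × (Fin l → Traj d (k + 1))) :=
  (Measure.pi fun i => fateLaw M F (x i)).prod (Measure.pi fun _ : Fin l => birthMeasure M (k + 1))

instance {m : ℕ} (x : Fin m → Traj d k) (l : ℕ) : IsFiniteMeasure (fatesLaw M F x l) := by
  unfold fatesLaw
  infer_instance

/-- The weight `e^{-∫ λ} / l!` of the configurations with `l` new born trajectories. -/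
noncomputable def birthWeight (k l : ℕ) : ℝ≥0∞ :=
  ENNReal.ofReal (Real.exp (-∫ X, birthIntensity M k X ∂(trajMeasure d k))) / l.factorial

theorem measurable_joinFates (m l : ℕ) :
    Measurable fun q : (Fin m → Traj d k ⊕ Unit) × (Fin l → Traj d k) =>
      (FinSets.ofTuple q.2).adjoinTuple q.1 :=
  (FinSets.measurable_adjoinTuple l m).comp measurable_swap

/-- The transition in terms of a tuple of distinct trajectories, whose fates are indexed by the
positions in the tuple. -/
theorem multiTransition_ofTuple {m : ℕ} {x : Fin m → Traj d k} (hx : Function.Injective x) :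
    multiTransition M F (FinSets.ofTuple x) = Measure.sum fun l : ℕ =>
      birthWeight M (k + 1) l • (fatesLaw M F x l).map fun q =>
        (FinSets.ofTuple q.2).adjoinTuple q.1 := by
  have hbij : Function.Bijective fun i : Fin m =>
      (⟨x i, FinSets.mem_ofTuple.2 ⟨i, rfl⟩⟩ : (FinSets.ofTuple x).toFinset) := by
    refine ⟨fun i j h => hx (congrArg Subtype.val h), fun X => ?_⟩
    obtain ⟨i, hi⟩ := FinSets.mem_ofTuple.1 X.2
    exact ⟨i, Subtype.ext hi⟩
  set e := Equiv.ofBijective _ hbij with he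
  have hex : ∀ i, (e i : Traj d k) = x i := fun i => rfl
  unfold multiTransition
  congr 1
  funext l
  rw [birthWeight]
  congr 1
  have hfate := (measurePreserving_piCongrLeft
    (fun X : (FinSets.ofTuple x).toFinset => fateLaw M F X.1) e).symm _
  have hbirth := MeasurePreserving.id (Measure.pi fun _ : Fin l => birthMeasure M (k + 1))
  have hs : SFinite (Measure.pi fun _ : Fin l => birthMeasure M (k + 1)) := inferInstance
  have hs2 : SFinite (Measure.pi fun X : (FinSets.ofTuple x).toFinset => fateLaw M F X.1) :=
    inferInstance
  have hmp := hfate.prod hbirth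
  change Measure.map _ ((Measure.pi fun X : (FinSets.ofTuple x).toFinset => fateLaw M F X.1).prod
    (Measure.pi fun _ : Fin l => birthMeasure M (k + 1))) = _
  have h2 : fatesLaw M F x l = _ := hmp.map_eq.symm
  rw [h2, Measure.map_map (measurable_joinFates m l) hmp.measurable]
  congr 1
  funext ω
  refine FinSets.ext_mem fun Y => ?_
  simp only [nextSet, Function.comp_apply, FinSets.mem_adjoinTuple, FinSets.mem_ofTuple,
    Finset.mem_union, Finset.mem_biUnion, Finset.mem_univ, true_and, Finset.mem_image]
  rw [or_comm]
  refine or_congr Iff.rfl ?_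
  rw [← e.exists_congr_right]
  refine exists_congr fun i => ?_
  change _ ↔ ω.1 (e i) = Sum.inl Y
  rcases ω.1 (e i) with Z | _ <;> simp [eq_comm]

theorem measurable_pi_fateLaw (m : ℕ) :
    Measurable fun x : Fin m → Traj d k => Measure.pi fun i => fateLaw M F (x i) := by
  refine Measurable.measure_of_isPiSystem_of_isProbabilityMeasure generateFrom_pi.symm
    isPiSystem_pi ?_
  rintro _ ⟨s, hs, rfl⟩
  simp only [Measure.pi_pi]
  refine Finset.measurable_prod _ fun i _ => ?_
  exact (Measure.measurable_coe (show MeasurableSet (s i) from hs i trivial)).comp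
    ((measurable_fateLaw M F).comp (measurable_pi_apply i))

theorem measurable_multiTransition :
    Measurable (multiTransition M F :
      FinSets (Traj d k) → Measure (FinSets (Traj d (k + 1)))) := by
  refine FinSets.measurable_of_injective_tuples _ (fun m => ?_)
    (fun m x hx => multiTransition_ofTuple M F hx)
  refine Measure.measurable_of_measurable_coe _ fun B hB => ?_
  simp only [Measure.sum_apply _ hB, Measure.smul_apply, smul_eq_mul]
  refine Measurable.tsum fun l => Measurable.const_mul ?_ _
  have hJ := measurable_joinFates (d := d) (k := k + 1) m l hB
  simp only [Measure.map_apply (measurable_joinFates m l) hB, fatesLaw, Measure.prod_apply hJ]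
  exact (Measure.measurable_lintegral (measurable_measure_prodMk_left hJ)).comp
    (measurable_pi_fateLaw M F m)

/-- The operator `ψ ↦ (S ↦ E[ψ(next set) | current set S])`. -/
noncomputable def multiTransitionOp :
    TestFun (Traj d (k + 1)) →ₗ[ℝ≥0∞] TestFun (Traj d k) where
  toFun ψ := ⟨fun S => ∫⁻ T, ψ.1 T ∂(multiTransition M F S),
    (Measure.measurable_lintegral ψ.2).comp (measurable_multiTransition M F)⟩
  map_add' ψ _ := Subtype.ext <| funext fun _ => lintegral_add_left ψ.2 _
  map_smul' c ψ := Subtype.ext <| funext fun _ => lintegral_const_mul c ψ.2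

theorem multiTransitionOp_apply (ψ : TestFun (Traj d (k + 1))) (S : FinSets (Traj d k)) :
    (multiTransitionOp M F ψ).1 S = ∫⁻ T, ψ.1 T ∂(multiTransition M F S) := rfl

theorem TestFun.measurable_joinFates (ψ : TestFun (Traj d k)) (m l : ℕ) :
    Measurable fun q : (Fin m → Traj d k ⊕ Unit) × (Fin l → Traj d k) =>
      ψ.1 ((FinSets.ofTuple q.2).adjoinTuple q.1) :=
  ψ.measurable.comp (TrajectoryPMB.measurable_joinFates m l)

theorem multiTransitionOp_ofTuple (ψ : TestFun (Traj d (k + 1))) {m : ℕ} {x : Fin m → Traj d k}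
    (hx : Function.Injective x) :
    (multiTransitionOp M F ψ).1 (FinSets.ofTuple x) = ∑' l : ℕ, birthWeight M (k + 1) l *
      ∫⁻ q, ψ.1 ((FinSets.ofTuple q.2).adjoinTuple q.1) ∂(fatesLaw M F x l) := by
  rw [multiTransitionOp_apply, multiTransition_ofTuple M F hx, lintegral_sum_measure]
  refine tsum_congr fun l => ?_
  rw [lintegral_smul_measure, lintegral_map ψ.measurable (measurable_joinFates m l), smul_eq_mul]

/-- A trajectory adjoined to the current set contributes its fate to the next set. -/
theorem multiTransitionOp_adjoin (ψ : TestFun (Traj d (k + 1))) {S : FinSets (Traj d k)}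
    {X : Traj d k} (hX : X ∉ S.toFinset) :
    (multiTransitionOp M F ψ).1 (S.adjoin (Sum.inl X)) =
      (multiTransitionOp M F (adjoinOp (fateLaw M F X) ψ)).1 S := by
  obtain ⟨m, x, hx, rfl⟩ := S.exists_injective_ofTuple
  have hinj : Function.Injective (Fin.cons X x : Fin (m + 1) → Traj d k) := by
    refine Fin.cons_injective_iff.2 ⟨fun h => hX ?_, hx⟩
    obtain ⟨i, hi⟩ := h
    exact FinSets.mem_ofTuple.2 ⟨i, hi⟩
  rw [FinSets.ofTuple_adjoin, multiTransitionOp_ofTuple M F ψ hinj,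
    multiTransitionOp_ofTuple M F _ hx]
  refine tsum_congr fun l => congrArg _ ?_
  have hm1 := ψ.measurable_joinFates (m + 1) l
  rw [fatesLaw, fatesLaw, lintegral_prod _ hm1.aemeasurable,
    lintegral_prod _ (TestFun.measurable_joinFates _ m l).aemeasurable]
  refine (lintegral_pi_succ (fun i => fateLaw M F ((Fin.cons X x : Fin (m + 1) → Traj d k) i)) 0
    hm1.lintegral_prod_right').trans ?_
  refine lintegral_congr fun z => ?_
  simp only [adjoinOp_apply, Fin.insertNth_zero', Fin.cons_zero, FinSets.adjoin_adjoinTuple]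
  refine lintegral_lintegral_swap (Measurable.aemeasurable ?_)
  have hq : Measurable fun q : (Traj d (k + 1) ⊕ Unit) × (Fin l → Traj d (k + 1)) =>
      ((Fin.cons q.1 z : Fin (m + 1) → Traj d (k + 1) ⊕ Unit), q.2) :=
    (FinSets.measurable_finCons measurable_fst measurable_const).prodMk measurable_snd
  have h := hm1.comp hq
  exact h

/-- `fateLaw` as a Markov kernel. -/
noncomputable def fateKernel :
    ProbabilityTheory.Kernel (Traj d k) (Traj d (k + 1) ⊕ Unit) :=
  ⟨fateLaw M F, measurable_fateLaw M F⟩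

instance : ProbabilityTheory.IsMarkovKernel (fateKernel M F : ProbabilityTheory.Kernel (Traj d k) _) :=
  ⟨fun X => inferInstanceAs (IsProbabilityMeasure (fateLaw M F X))⟩

/-- Averaging the fate of `X` over a random trajectory `X` with law `a`. The order of integration
is exchanged on tuples, where the integrands are jointly measurable. -/
theorem lintegral_multiTransitionOp_fateLaw (a : Measure (Traj d k)) [IsFiniteMeasure a]
    (ψ : TestFun (Traj d (k + 1))) (S : FinSets (Traj d k)) :
    ∫⁻ X, (multiTransitionOp M F (adjoinOp (fateLaw M F X) ψ)).1 S ∂a =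
      (multiTransitionOp M F (adjoinOp (a.bind (fateKernel M F)) ψ)).1 S := by
  obtain ⟨m, x, hx, rfl⟩ := S.exists_injective_ofTuple
  simp only [multiTransitionOp_ofTuple M F _ hx]
  have hjoint : ∀ l, Measurable fun u : Traj d k ×
      ((Fin m → Traj d (k + 1) ⊕ Unit) × (Fin l → Traj d (k + 1))) =>
      (adjoinOp (fateLaw M F u.1) ψ).1 ((FinSets.ofTuple u.2.2).adjoinTuple u.2.1) := by
    intro l
    have hq : Measurable fun v : (Traj d k × ((Fin m → Traj d (k + 1) ⊕ Unit) ×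
        (Fin l → Traj d (k + 1)))) × (Traj d (k + 1) ⊕ Unit) =>
        ((Fin.cons v.2 v.1.2.1 : Fin (m + 1) → Traj d (k + 1) ⊕ Unit), v.1.2.2) :=
      (FinSets.measurable_finCons measurable_snd
        (measurable_fst.comp (measurable_snd.comp measurable_fst))).prodMk
        (measurable_snd.comp (measurable_snd.comp measurable_fst))
    have h := (ψ.measurable_joinFates (m + 1) l).comp hq
    have h2 := Measurable.lintegral_kernel_prod_right'
      (κ := (fateKernel M F).prodMkRight _) h
    simp only [adjoinOp_apply, FinSets.adjoin_adjoinTuple]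
    exact h2
  have hl : ∀ l, Measurable fun X => ∫⁻ q, (adjoinOp (fateLaw M F X) ψ).1
      ((FinSets.ofTuple q.2).adjoinTuple q.1) ∂(fatesLaw M F x l) := fun l =>
    (hjoint l).lintegral_prod_right'
  rw [lintegral_tsum fun l => ((hl l).const_mul _).aemeasurable]
  refine tsum_congr fun l => ?_
  rw [lintegral_const_mul _ (hl l)]
  congr 1
  rw [lintegral_lintegral_swap (hjoint l).aemeasurable]
  refine lintegral_congr fun q => ?_
  simp only [adjoinOp_apply]
  rw [Measure.lintegral_bind (fateKernel M F).measurable.aemeasurable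
    (ψ.measurable_adjoin _).aemeasurable]
  rfl

/-- Adjoining a random trajectory before the transition amounts to adjoining its fate after it. -/
theorem adjoinOp_multiTransitionOp (a : Measure (Traj d k)) [IsFiniteMeasure a]
    [NullSingletonClass a] (ψ : TestFun (Traj d (k + 1))) :
    adjoinOp (a.map Sum.inl) (multiTransitionOp M F ψ) =
      multiTransitionOp M F (adjoinOp (a.bind (fateKernel M F)) ψ) := by
  refine Subtype.ext (funext fun S => ?_)
  rw [adjoinOp_inl_apply, ← lintegral_multiTransitionOp_fateLaw]
  refine lintegral_congr_ae ?_
  have h : ∀ᵐ X ∂a, X ∉ S.toFinset := by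
    have h0 : a (S.toFinset : Set (Traj d k)) = 0 := S.toFinset.measure_zero a
    rw [ae_iff]
    simpa using h0
  filter_upwards [h] with X hX
  exact multiTransitionOp_adjoin M F ψ hX

/-- From the empty set, only new born trajectories arise. -/
theorem multiTransitionOp_empty (ψ : TestFun (Traj d (k + 1))) :
    (multiTransitionOp M F ψ).1 (⟨∅⟩ : FinSets (Traj d k)) =
      ENNReal.ofReal (Real.exp (-∫ X, birthIntensity M (k + 1) X ∂(trajMeasure d (k + 1)))) *
        expAtEmpty (adjoinOp ((birthMeasure M (k + 1)).map Sum.inl)) ψ := by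
  have h0 : (⟨∅⟩ : FinSets (Traj d k)) = FinSets.ofTuple (Fin.elim0 : Fin 0 → Traj d k) :=
    FinSets.ext_mem fun X => by simp
  rw [h0, multiTransitionOp_ofTuple M F ψ fun i => i.elim0, ← tsum_lintegral_pi_ofTuple,
    ← ENNReal.tsum_mul_left]
  refine tsum_congr fun l => ?_
  rw [birthWeight, div_eq_mul_inv, mul_assoc, fatesLaw,
    lintegral_prod _ (ψ.measurable_joinFates 0 l).aemeasurable]
  simp [FinSets.adjoinTuple_zero]

end MultiTransition

/-! ### Predicted parameters -/

section Prediction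

variable {d k : ℕ} (M : TargetModel d) (F : Formulation)

theorem integrable_mul_survival {a : Traj d k → ℝ} (ha : Integrable a (trajMeasure d k)) :
    Integrable (fun X => a X * survival M F X) (trajMeasure d k) := by
  refine ha.mul_bdd (c := 1) (measurable_survival M F).aestronglyMeasurable
    (Filter.Eventually.of_forall fun X => ?_)
  rw [Real.norm_of_nonneg (survival_nonneg M F X)]
  exact survival_le_one M F X

theorem pairing_nonneg {a : Traj d k → ℝ} (ha0 : ∀ X, 0 ≤ a X) :
    0 ≤ pairing a (survival M F) :=
  integral_nonneg fun X => mul_nonneg (ha0 X) (survival_nonneg M F X)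

theorem pairing_le {a : Traj d k → ℝ} (ha : Integrable a (trajMeasure d k))
    (ha0 : ∀ X, 0 ≤ a X) : pairing a (survival M F) ≤ ∫ X, a X ∂(trajMeasure d k) :=
  integral_mono (integrable_mul_survival M F ha) ha fun X =>
    mul_le_of_le_one_right (ha0 X) (survival_le_one M F X)

theorem lintegral_transitionPairing {a : Traj d k → ℝ} (ha : IsIntensity (trajMeasure d k) a) :
    ∫⁻ Y, ENNReal.ofReal (transitionPairing M F a Y) ∂(trajMeasure d (k + 1)) =
      ENNReal.ofReal (pairing a (survival M F)) := by
  have h := lintegral_transition M F ha.measurable ha.nonneg (f := fun _ => 1) measurable_const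
  simp only [lintegral_const, measure_univ, mul_one] at h
  rw [← h, pairing, ofReal_integral_eq_lintegral_ofReal (integrable_mul_survival M F ha.integrable)
    (Filter.Eventually.of_forall fun X => mul_nonneg (ha.nonneg X) (survival_nonneg M F X))]
  exact lintegral_congr fun X => (ENNReal.ofReal_mul (ha.nonneg X)).symm

theorem isIntensity_transitionPairing {a : Traj d k → ℝ} (ha : IsIntensity (trajMeasure d k) a) :
    IsIntensity (trajMeasure d (k + 1)) (transitionPairing M F a) := by
  have hm := measurable_transitionPairing M F ha.measurable
  refine ⟨hm, transitionPairing_nonneg M F ha.nonneg, hm.aestronglyMeasurable, ?_⟩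
  rw [hasFiniteIntegral_iff_ofReal (Filter.Eventually.of_forall
    (transitionPairing_nonneg M F ha.nonneg)), lintegral_transitionPairing M F ha]
  exact ENNReal.ofReal_lt_top

theorem integral_transitionPairing {a : Traj d k → ℝ} (ha : IsIntensity (trajMeasure d k) a) :
    ∫ Y, transitionPairing M F a Y ∂(trajMeasure d (k + 1)) = pairing a (survival M F) := by
  rw [integral_eq_lintegral_of_nonneg_ae (Filter.Eventually.of_forall
    (transitionPairing_nonneg M F ha.nonneg))
    (measurable_transitionPairing M F ha.measurable).aestronglyMeasurable,
    lintegral_transitionPairing M F ha, ENNReal.toReal_ofReal (pairing_nonneg M F ha.nonneg)]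

theorem IsDensity.isIntensity {α : Type*} [MeasurableSpace α] {μ : Measure α} {p : α → ℝ}
    (hp : IsDensity μ p) : IsIntensity μ p :=
  ⟨hp.measurable, hp.nonneg, hp.integrable⟩

theorem isIntensity_predIntensity {lam : Traj d k → ℝ} (hlam : IsIntensity (trajMeasure d k) lam) :
    IsIntensity (trajMeasure d (k + 1)) (predIntensity M F lam) := by
  have h1 := isIntensity_birthIntensity M (k + 1)
  have h2 := isIntensity_transitionPairing M F hlam
  exact ⟨h1.measurable.add h2.measurable, fun Y => add_nonneg (h1.nonneg Y) (h2.nonneg Y),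
    h1.integrable.add h2.integrable⟩

theorem predExistence_mem {r : ℝ} {p : Traj d k → ℝ} (hr : 0 ≤ r ∧ r ≤ 1)
    (hp : IsDensity (trajMeasure d k) p) :
    0 ≤ predExistence M F r p ∧ predExistence M F r p ≤ 1 := by
  have h1 := pairing_nonneg M F hp.nonneg
  have h2 := pairing_le M F hp.integrable hp.nonneg
  rw [hp.integral_eq_one] at h2
  exact ⟨mul_nonneg hr.1 h1, mul_le_one₀ hr.2 h1 h2⟩

theorem measurable_predDensity {p : Traj d k → ℝ} (hp : Measurable p) :
    Measurable (predDensity M F p) :=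
  (measurable_transitionPairing M F hp).div_const _

theorem predDensity_nonneg {p : Traj d k → ℝ} (hp : ∀ X, 0 ≤ p X) (Y : Traj d (k + 1)) :
    0 ≤ predDensity M F p Y :=
  div_nonneg (transitionPairing_nonneg M F hp Y) (pairing_nonneg M F hp)

theorem isDensity_predDensity {p : Traj d k → ℝ} (hp : IsDensity (trajMeasure d k) p)
    (h : pairing p (survival M F) ≠ 0) :
    IsDensity (trajMeasure d (k + 1)) (predDensity M F p) := by
  refine ⟨measurable_predDensity M F hp.measurable, predDensity_nonneg M F hp.nonneg, ?_⟩
  simp only [predDensity]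
  rw [integral_div, integral_transitionPairing M F hp.isIntensity, div_self h]

/-- The product `r p` of the predicted parameters, also where the division in `predDensity` is by
zero: if `⟨p, p^S⟩ = 0`, both sides vanish almost everywhere. -/
theorem predExistence_mul_predDensity_ae {r : ℝ} {p : Traj d k → ℝ}
    (hp : IsDensity (trajMeasure d k) p) :
    ∀ᵐ Y ∂(trajMeasure d (k + 1)), predExistence M F r p * predDensity M F p Y =
      r * transitionPairing M F p Y := by
  by_cases h : pairing p (survival M F) = 0
  · have h1 := lintegral_transitionPairing M F hp.isIntensity
    rw [h, ENNReal.ofReal_zero, lintegral_eq_zero_iff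
      (measurable_transitionPairing M F hp.measurable).ennreal_ofReal] at h1
    filter_upwards [h1] with Y hY
    have h2 : transitionPairing M F p Y = 0 :=
      le_antisymm (ENNReal.ofReal_eq_zero.1 hY) (transitionPairing_nonneg M F hp.nonneg Y)
    simp [predDensity, h2]
  · refine Filter.Eventually.of_forall fun Y => ?_
    rw [predExistence, predDensity]
    field_simp

/-- The law of the fate of a random trajectory: it is thinned with the probability of survival,
and moved by the transition. -/
theorem bind_fateKernel {a : Traj d k → ℝ} (ha : IsIntensity (trajMeasure d k) a) :
    ((trajMeasure d k).withDensity fun X => ENNReal.ofReal (a X)).bind (fateKernel M F) =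
      ((trajMeasure d (k + 1)).withDensity fun Y =>
        ENNReal.ofReal (transitionPairing M F a Y)).map Sum.inl +
      ENNReal.ofReal ((∫ X, a X ∂(trajMeasure d k)) - pairing a (survival M F)) •
        Measure.dirac (Sum.inr ()) := by
  refine Measure.ext_of_lintegral _ fun f hf => ?_
  have hfl : Measurable fun Y : Traj d (k + 1) => f (Sum.inl Y) := hf.comp measurable_inl
  have hs := measurable_survival (k := k) M F
  have hL : Measurable fun X => ∫⁻ z, f z ∂(fateKernel M F X) := hf.lintegral_kernel
  have hT : Measurable fun X => ∫⁻ Y, f (Sum.inl Y) ∂(transition M F X) :=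
    (Measure.measurable_lintegral hfl).comp (measurable_transition M F)
  rw [Measure.lintegral_bind (fateKernel M F).measurable.aemeasurable hf.aemeasurable,
    lintegral_withDensity_eq_lintegral_mul _ ha.measurable.ennreal_ofReal hL,
    lintegral_add_measure, lintegral_map hf measurable_inl, lintegral_smul_measure,
    lintegral_dirac' _ hf, lintegral_withDensity_eq_lintegral_mul _
    (measurable_transitionPairing M F ha.measurable).ennreal_ofReal hfl]
  simp only [Pi.mul_apply]
  rw [← lintegral_transition M F ha.measurable ha.nonneg hfl]
  have hdead : ENNReal.ofReal ((∫ X, a X ∂(trajMeasure d k)) - pairing a (survival M F)) =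
      ∫⁻ X, ENNReal.ofReal (a X) * ENNReal.ofReal (1 - survival M F X) ∂(trajMeasure d k) := by
    have hint : Integrable (fun X => a X - a X * survival M F X) (trajMeasure d k) :=
      ha.integrable.sub (integrable_mul_survival M F ha.integrable)
    rw [pairing, ← integral_sub ha.integrable (integrable_mul_survival M F ha.integrable),
      ofReal_integral_eq_lintegral_ofReal hint]
    · refine lintegral_congr fun X => ?_
      rw [← ENNReal.ofReal_mul (ha.nonneg X), mul_sub, mul_one]
    · refine Filter.Eventually.of_forall fun X => ?_
      exact sub_nonneg.2 (mul_le_of_le_one_right (ha.nonneg X) (survival_le_one M F X))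
  have hm1 : Measurable fun X => ENNReal.ofReal (a X) * (ENNReal.ofReal (survival M F X) *
      ∫⁻ Y, f (Sum.inl Y) ∂(transition M F X)) :=
    ha.measurable.ennreal_ofReal.mul (hs.ennreal_ofReal.mul hT)
  have hm2 : Measurable fun X => ENNReal.ofReal (a X) * ENNReal.ofReal (1 - survival M F X) :=
    ha.measurable.ennreal_ofReal.mul (measurable_const.sub hs).ennreal_ofReal
  rw [hdead, smul_eq_mul, ← lintegral_mul_const _ hm2, ← lintegral_add_left hm1]
  refine lintegral_congr fun X => ?_
  change _ * ∫⁻ z, f z ∂(fateLaw M F X) = _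
  rw [lintegral_fateLaw M F X hf]
  ring

/-- Prediction of a Bernoulli component. -/
theorem adjoinOp_bernoulliLaw_multiTransitionOp (hd : 0 < d) {r : ℝ} {p : Traj d k → ℝ}
    (hr : 0 ≤ r ∧ r ≤ 1) (hp : IsDensity (trajMeasure d k) p) (ψ : TestFun (Traj d (k + 1))) :
    adjoinOp (bernoulliLaw (trajMeasure d k) r p) (multiTransitionOp M F ψ) =
      multiTransitionOp M F (adjoinOp (bernoulliLaw (trajMeasure d (k + 1))
        (predExistence M F r p) (predDensity M F p)) ψ) := by
  have hrp : IsIntensity (trajMeasure d k) fun X => r * p X :=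
    ⟨hp.measurable.const_mul r, fun X => mul_nonneg hr.1 (hp.nonneg X), hp.integrable.const_mul r⟩
  have := nullSingletonClass_trajMeasure (k := k) hd
  set a := (trajMeasure d k).withDensity fun X => ENNReal.ofReal (r * p X) with ha
  have hfin : IsFiniteMeasure a := isFiniteMeasure_withDensity_ofReal hrp.integrable.2
  have hnull : NullSingletonClass a :=
    ⟨fun X => withDensity_absolutelyContinuous _ _ (measure_singleton X)⟩
  have htp : ∀ Y, transitionPairing M F (fun X => r * p X) Y = r * transitionPairing M F p Y :=
    fun Y => by simp only [transitionPairing, mul_assoc, integral_const_mul]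
  have hpair : pairing (fun X => r * p X) (survival M F) = predExistence M F r p := by
    simp only [pairing, predExistence, mul_assoc, integral_const_mul]
  have hle : predExistence M F r p ≤ r := by
    have h := pairing_le M F hp.integrable hp.nonneg
    rw [hp.integral_eq_one] at h
    exact mul_le_of_le_one_right hr.1 h
  -- the fate of the component, where a component that is absent remains absent
  have hlaw : bernoulliLaw (trajMeasure d (k + 1)) (predExistence M F r p) (predDensity M F p) =
      a.bind (fateKernel M F) + ENNReal.ofReal (1 - r) • Measure.dirac (Sum.inr ()) := by
    rw [ha, bind_fateKernel M F hrp, hpair, integral_const_mul, hp.integral_eq_one, mul_one,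
      add_assoc, ← add_smul, ← ENNReal.ofReal_add (by linarith) (by linarith [hr.2]),
      bernoulliLaw]
    congr 1
    · refine congrArg (Measure.map Sum.inl) (withDensity_congr_ae ?_)
      filter_upwards [predExistence_mul_predDensity_ae M F (r := r) hp] with Y hY
      rw [hY, htp]
    · congr 2
      ring
  rw [adjoinOp_congr hlaw, adjoinOp_add, adjoinOp_smul_dirac]
  have hsplit : adjoinOp (bernoulliLaw (trajMeasure d k) r p) =
      adjoinOp (a.map Sum.inl) + ENNReal.ofReal (1 - r) • 1 := by
    rw [← adjoinOp_smul_dirac (ENNReal.ofReal (1 - r)) (), ← adjoinOp_add]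
    rfl
  rw [hsplit, LinearMap.add_apply, LinearMap.add_apply, map_add, adjoinOp_multiTransitionOp,
    LinearMap.smul_apply, LinearMap.smul_apply, map_smul]
  rfl

/-- Prediction of a Poisson process. -/
theorem lintegral_multiTransitionOp_poisson (hd : 0 < d) {lam : Traj d k → ℝ}
    (hlam : IsIntensity (trajMeasure d k) lam) (r r' : Fin 0 → ℝ) (p : Fin 0 → Traj d k → ℝ)
    (p' : Fin 0 → Traj d (k + 1) → ℝ) (ψ : TestFun (Traj d (k + 1))) :
    ∫⁻ S, (multiTransitionOp M F ψ).1 S *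
        ENNReal.ofReal (pmbDensity (trajMeasure d k) lam r p S) ∂(setMeasure (trajMeasure d k)) =
      ∫⁻ T, ψ.1 T * ENNReal.ofReal (pmbDensity (trajMeasure d (k + 1))
        (predIntensity M F lam) r' p' T) ∂(setMeasure (trajMeasure d (k + 1))) := by
  have := nullSingletonClass_trajMeasure (k := k) hd
  have := nullSingletonClass_trajMeasure (k := k + 1) hd
  have hpred := isIntensity_predIntensity M F hlam
  have hbirth := isIntensity_birthIntensity M (k + 1)
  have htp := isIntensity_transitionPairing M F hlam
  rw [lintegral_pmbDensity_zero _ hlam, lintegral_pmbDensity_zero _ hpred]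
  set a := (trajMeasure d k).withDensity fun X => ENNReal.ofReal (lam X) with ha
  set b := (trajMeasure d (k + 1)).withDensity fun Y =>
    ENNReal.ofReal (transitionPairing M F lam Y) with hb
  set c := (∫ X, lam X ∂(trajMeasure d k)) - pairing lam (survival M F) with hc
  have hc0 : 0 ≤ c := sub_nonneg.2 (pairing_le M F hlam.integrable hlam.nonneg)
  have hfin : IsFiniteMeasure a := isFiniteMeasure_withDensity_ofReal hlam.integrable.2
  have hfinb : IsFiniteMeasure b := isFiniteMeasure_withDensity_ofReal htp.integrable.2
  have hnull : NullSingletonClass a :=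
    ⟨fun X => withDensity_absolutelyContinuous _ _ (measure_singleton X)⟩
  set A := adjoinOp ((birthMeasure M (k + 1)).map Sum.inl) with hA
  set B := adjoinOp (a.bind (fateKernel M F)) with hB
  have hpow : ∀ (m : ℕ) (φ : TestFun (Traj d (k + 1))),
      (adjoinOp (a.map Sum.inl) ^ m) (multiTransitionOp M F φ) =
        multiTransitionOp M F ((B ^ m) φ) := by
    intro m
    induction m with
    | zero => intro φ; rfl
    | succ m ih =>
      intro φ
      rw [pow_succ, pow_succ, Module.End.mul_apply, Module.End.mul_apply,
        adjoinOp_multiTransitionOp, ih]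
  have hBsplit : B = adjoinOp (b.map Sum.inl) + ENNReal.ofReal c • 1 := by
    rw [hB, adjoinOp_congr (bind_fateKernel M F hlam), adjoinOp_add, adjoinOp_smul_dirac]
  have hsum : (trajMeasure d (k + 1)).withDensity
      (fun Y => ENNReal.ofReal (predIntensity M F lam Y)) = birthMeasure M (k + 1) + b := by
    rw [hb, birthMeasure, ← withDensity_add_left hbirth.measurable.ennreal_ofReal]
    congr 1
    funext Y
    exact ENNReal.ofReal_add (hbirth.nonneg Y) (htp.nonneg Y)
  have hAB : A + B = adjoinOp (((trajMeasure d (k + 1)).withDensity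
      (fun Y => ENNReal.ofReal (predIntensity M F lam Y))).map Sum.inl) + ENNReal.ofReal c • 1 := by
    have h : ((trajMeasure d (k + 1)).withDensity
        (fun Y => ENNReal.ofReal (predIntensity M F lam Y))).map
          (Sum.inl : Traj d (k + 1) → Traj d (k + 1) ⊕ Unit) =
        (birthMeasure M (k + 1)).map Sum.inl + b.map Sum.inl := by
      rw [hsum, Measure.map_add _ _ measurable_inl]
    rw [adjoinOp_congr h, adjoinOp_add, hBsplit, add_assoc]
  have hexp : expAtEmpty (adjoinOp (a.map Sum.inl)) (multiTransitionOp M F ψ) =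
      ENNReal.ofReal (Real.exp (-∫ X, birthIntensity M (k + 1) X ∂(trajMeasure d (k + 1)))) *
        (ENNReal.ofReal (Real.exp c) * expAtEmpty (adjoinOp (((trajMeasure d (k + 1)).withDensity
          (fun Y => ENNReal.ofReal (predIntensity M F lam Y))).map Sum.inl)) ψ) := by
    rw [← expAtEmpty_add_smul_one _ hc0, ← hAB, expAtEmpty_add (adjoinOp_commute _ _),
      ← ENNReal.tsum_mul_left, expAtEmpty]
    refine tsum_congr fun m => ?_
    rw [hpow, multiTransitionOp_empty]
    ring
  rw [hexp, ← mul_assoc, ← mul_assoc, ← ENNReal.ofReal_mul (Real.exp_pos _).le,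
    ← ENNReal.ofReal_mul (by positivity), ← Real.exp_add, ← Real.exp_add]
  congr 3
  have h1 : ∫ Y, predIntensity M F lam Y ∂(trajMeasure d (k + 1)) =
      (∫ Y, birthIntensity M (k + 1) Y ∂(trajMeasure d (k + 1))) +
        pairing lam (survival M F) := by
    rw [← integral_transitionPairing M F hlam, ← integral_add hbirth.integrable htp.integrable]
    rfl
  rw [h1, hc]
  ring

/-- The prediction of a PMB density, tested against `ψ`; the Bernoulli components are removed one
by one. -/
theorem lintegral_multiTransitionOp_pmbDensity (hd : 0 < d) {n : ℕ} {lam : Traj d k → ℝ}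
    (hlam : IsIntensity (trajMeasure d k) lam) {r : Fin n → ℝ} {p : Fin n → Traj d k → ℝ}
    (hr : ∀ i, 0 ≤ r i ∧ r i ≤ 1) (hp : ∀ i, IsDensity (trajMeasure d k) (p i))
    (ψ : TestFun (Traj d (k + 1))) :
    ∫⁻ S, (multiTransitionOp M F ψ).1 S *
        ENNReal.ofReal (pmbDensity (trajMeasure d k) lam r p S) ∂(setMeasure (trajMeasure d k)) =
      ∫⁻ T, ψ.1 T * ENNReal.ofReal (pmbDensity (trajMeasure d (k + 1))
        (predIntensity M F lam) (fun i => predExistence M F (r i) (p i))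
        (fun i => predDensity M F (p i)) T) ∂(setMeasure (trajMeasure d (k + 1))) := by
  have := nullSingletonClass_trajMeasure (k := k) hd
  have := nullSingletonClass_trajMeasure (k := k + 1) hd
  induction n generalizing ψ with
  | zero => exact lintegral_multiTransitionOp_poisson M F hd hlam _ _ _ _ ψ
  | succ n ih =>
    rw [lintegral_pmbDensity_succ _ hlam hr (fun i => (hp i).measurable) fun i => (hp i).nonneg,
      lintegral_pmbDensity_succ _ (isIntensity_predIntensity M F hlam)
        (fun i => predExistence_mem M F (hr i) (hp i))
        (fun i => measurable_predDensity M F (hp i).measurable)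
        fun i => predDensity_nonneg M F (hp i).nonneg,
      adjoinOp_bernoulliLaw_multiTransitionOp M F hd (hr 0) (hp 0)]
    exact ih (fun i => hr i.succ) (fun i => hp i.succ) _

/-! ### The predicted law -/

instance (S : FinSets (Traj d k)) : IsProbabilityMeasure (multiTransition M F S) := by
  refine ⟨?_⟩
  obtain ⟨m, x, hx, rfl⟩ := S.exists_injective_ofTuple
  have h := multiTransitionOp_ofTuple M F ⟨fun _ => 1, measurable_const⟩ hx
  rw [multiTransitionOp_apply] at h
  simp only [lintegral_const, one_mul] at h
  rw [h]
  set β := ∫ X, birthIntensity M (k + 1) X ∂(trajMeasure d (k + 1)) with hβ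
  have hb := isIntensity_birthIntensity M (k + 1)
  have hmass : birthMeasure M (k + 1) Set.univ = ENNReal.ofReal β := by
    rw [birthMeasure, withDensity_apply _ MeasurableSet.univ, Measure.restrict_univ, hβ,
      ofReal_integral_eq_lintegral_ofReal hb.integrable (Filter.Eventually.of_forall hb.nonneg)]
  have hfates : ∀ l, fatesLaw M F x l Set.univ = ENNReal.ofReal β ^ l := fun l => by
    rw [fatesLaw, ← Set.univ_prod_univ, Measure.prod_prod, measure_univ, one_mul,
      Measure.pi_univ]
    simp [hmass]
  have hβ0 : 0 ≤ β := integral_nonneg hb.nonneg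
  calc ∑' l, birthWeight M (k + 1) l * fatesLaw M F x l Set.univ
      = ENNReal.ofReal (Real.exp (-β)) *
          ∑' l : ℕ, (l.factorial : ℝ≥0∞)⁻¹ * ENNReal.ofReal β ^ l := by
        rw [← ENNReal.tsum_mul_left]
        refine tsum_congr fun l => ?_
        rw [hfates, birthWeight, div_eq_mul_inv, mul_assoc]
    _ = 1 := by
        rw [tsum_inv_factorial_mul_pow hβ0, ← ENNReal.ofReal_mul (Real.exp_pos _).le,
          ← Real.exp_add, neg_add_cancel, Real.exp_zero, ENNReal.ofReal_one]

/-- The fate of an admissible trajectory is either admissible or to disappear. -/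
theorem ae_fateLaw_admits {X : Traj d k} (hX : F.Admits k X) :
    ∀ᵐ z ∂(fateLaw M F X), ∀ Y, z = Sum.inl Y → F.Admits (k + 1) Y := by
  cases F
  · have hX' : X.endTime = k := hX
    have hB : MeasurableSet {z : Traj d (k + 1) ⊕ Unit |
        Sum.elim (fun Y => Y.endTime = k + 1) (fun _ => True) z} := by
      rw [measurableSet_setOfPred]
      refine measurable_fun_sum ?_ measurable_const
      exact Traj.measurable_endTime.eq measurable_const
    have h : ∀ᵐ z ∂(fateLaw M .alive X),
        Sum.elim (fun Y => Y.endTime = k + 1) (fun _ => True) z := by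
      rw [fateLaw, ae_add_measure_iff]
      constructor
      · refine Measure.ae_smul_measure ?_ _
        rw [ae_map_iff measurable_inl.aemeasurable hB]
        change ∀ᵐ Y ∂(appendLaw M X), Y.endTime = k + 1
        rw [appendLaw, ae_map_iff X.measurable_extend.aemeasurable
          (measurableSet_eq_fun Traj.measurable_endTime measurable_const)]
        exact Filter.Eventually.of_forall fun y => by rw [Traj.endTime_extend, hX']
      · refine Measure.ae_smul_measure ?_ _
        rw [ae_dirac_iff hB]
        trivial
    filter_upwards [h] with z hz Y hY
    subst hY
    exact hz
  · exact Filter.Eventually.of_forall fun _ _ _ => trivial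

theorem ae_birthMeasure_admits : ∀ᵐ Y ∂(birthMeasure M k), F.Admits k Y := by
  have hm := (isIntensity_birthIntensity M k).measurable.ennreal_ofReal
  cases F
  · change ∀ᵐ Y ∂(birthMeasure M k), Y.endTime = k
    rw [birthMeasure, ae_withDensity_iff hm]
    refine Filter.Eventually.of_forall fun Y hY => ?_
    have h : Y.start = k ∧ Y.len = 1 := by
      by_contra h
      exact hY (by simp [birthIntensity, h])
    simp only [Traj.endTime, h.1, h.2]
    omega
  · exact Filter.Eventually.of_forall fun _ => trivial

theorem measurableSet_admits :
    MeasurableSet {S : FinSets (Traj d k) | ∀ X ∈ S.toFinset, F.Admits k X} := by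
  have hF : MeasurableSet {X : Traj d k | F.Admits k X} := by
    cases F
    · exact measurableSet_eq_fun Traj.measurable_endTime measurable_const
    · exact MeasurableSet.univ
  rw [measurableSet_setOfPred]
  refine FinSets.measurable_of_comp_ofTuple fun n => ?_
  have h : (fun x : Fin n → Traj d k => ∀ X ∈ (FinSets.ofTuple x).toFinset, F.Admits k X) =
      fun x => ∀ i, F.Admits k (x i) := by
    funext x
    simp
  rw [h]
  exact Measurable.forall fun i => (measurableSet_setOfPred.1 hF).comp (measurable_pi_apply i)

theorem ae_multiTransition_admits {S : FinSets (Traj d k)}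
    (hS : ∀ X ∈ S.toFinset, F.Admits k X) :
    ∀ᵐ T ∂(multiTransition M F S), ∀ Y ∈ T.toFinset, F.Admits (k + 1) Y := by
  obtain ⟨m, x, hx, rfl⟩ := S.exists_injective_ofTuple
  rw [multiTransition_ofTuple M F hx, Measure.ae_sum_iff' (measurableSet_admits F)]
  intro l
  refine Measure.ae_smul_measure ?_ _
  rw [ae_map_iff (measurable_joinFates m l).aemeasurable (measurableSet_admits F)]
  have h1 : ∀ᵐ q ∂(fatesLaw M F x l), ∀ i Y, q.1 i = Sum.inl Y → F.Admits (k + 1) Y := by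
    refine Measure.quasiMeasurePreserving_fst.ae (p := fun z : Fin m → Traj d (k + 1) ⊕ Unit =>
      ∀ i Y, z i = Sum.inl Y → F.Admits (k + 1) Y) ?_
    refine ae_all_iff.2 fun i => ?_
    exact (Measure.quasiMeasurePreserving_eval
      (μ := fun i => fateLaw M F (x i)) i).ae
      (ae_fateLaw_admits M F (hS _ (FinSets.mem_ofTuple.2 ⟨i, rfl⟩)))
  have h2 : ∀ᵐ q ∂(fatesLaw M F x l), ∀ i, F.Admits (k + 1) (q.2 i) := by
    refine Measure.quasiMeasurePreserving_snd.ae (p := fun y : Fin l → Traj d (k + 1) =>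
      ∀ i, F.Admits (k + 1) (y i)) ?_
    refine ae_all_iff.2 fun i => ?_
    have h : Measure.QuasiMeasurePreserving (Function.eval i)
        (Measure.pi fun _ : Fin l => birthMeasure M (k + 1)) (birthMeasure M (k + 1)) :=
      Measure.quasiMeasurePreserving_eval _ i
    exact h.ae (ae_birthMeasure_admits M F)
  filter_upwards [h1, h2] with q hq1 hq2 Y hY
  rcases FinSets.mem_adjoinTuple.1 hY with h | ⟨i, hi⟩
  · obtain ⟨i, rfl⟩ := FinSets.mem_ofTuple.1 h
    exact hq2 i
  · exact hq1 i Y hi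

theorem ae_predict_admits {P : Measure (FinSets (Traj d k))}
    (hadm : ∀ᵐ S ∂P, ∀ X ∈ S.toFinset, F.Admits k X) :
    ∀ᵐ S ∂(predict M F P), ∀ X ∈ S.toFinset, F.Admits (k + 1) X := by
  have hnull : predict M F P {S | ∀ X ∈ S.toFinset, F.Admits (k + 1) X}ᶜ = 0 := by
    rw [predict, Measure.bind_apply (measurableSet_admits F).compl
      (measurable_multiTransition M F).aemeasurable]
    refine (lintegral_congr_ae ?_).trans lintegral_zero
    filter_upwards [hadm] with S hS
    exact ae_multiTransition_admits M F hS
  exact hnull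

theorem predict_eq_withDensity (hd : 0 < d) {n : ℕ} {lam : Traj d k → ℝ}
    (hlam : IsIntensity (trajMeasure d k) lam) {r : Fin n → ℝ} {p : Fin n → Traj d k → ℝ}
    (hr : ∀ i, 0 ≤ r i ∧ r i ≤ 1) (hp : ∀ i, IsDensity (trajMeasure d k) (p i)) :
    predict M F ((setMeasure (trajMeasure d k)).withDensity fun S =>
        ENNReal.ofReal (pmbDensity (trajMeasure d k) lam r p S)) =
      (setMeasure (trajMeasure d (k + 1))).withDensity fun S => ENNReal.ofReal
        (pmbDensity (trajMeasure d (k + 1)) (predIntensity M F lam)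
          (fun i => predExistence M F (r i) (p i)) (fun i => predDensity M F (p i)) S) := by
  have hmeas := measurable_pmbDensity (μ := trajMeasure d k) (r := r) hlam.measurable
    fun i => (hp i).measurable
  have hmeas' := measurable_pmbDensity (μ := trajMeasure d (k + 1))
    (r := fun i => predExistence M F (r i) (p i)) (isIntensity_predIntensity M F hlam).measurable
    fun i => measurable_predDensity M F (hp i).measurable
  refine Measure.ext_of_lintegral _ fun f hf => ?_
  have hΦ : Measurable fun S => ∫⁻ T, f T ∂(multiTransition M F S) :=
    (multiTransitionOp M F ⟨f, hf⟩).measurable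
  rw [predict, Measure.lintegral_bind (measurable_multiTransition M F).aemeasurable
    hf.aemeasurable, lintegral_withDensity_eq_lintegral_mul _ hmeas.ennreal_ofReal hΦ,
    lintegral_withDensity_eq_lintegral_mul _ hmeas'.ennreal_ofReal hf]
  simp only [Pi.mul_apply, mul_comm (ENNReal.ofReal _)]
  exact lintegral_multiTransitionOp_pmbDensity M F hd hlam hr hp ⟨f, hf⟩

end Prediction

end TrajectoryPMB

theorem lemma2 {d : ℕ} (hd : 0 < d) (M : TrajectoryPMB.TargetModel d)
    (F : TrajectoryPMB.Formulation) (k : ℕ)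
    -- parameters of the filtering density at time step `k`
    (n : ℕ) (lam : TrajectoryPMB.Traj d k → ℝ) (r : Fin n → ℝ)
    (p : Fin n → TrajectoryPMB.Traj d k → ℝ)
    (hlam : TrajectoryPMB.IsIntensity (TrajectoryPMB.trajMeasure d k) lam)
    (hr : ∀ i, 0 ≤ r i ∧ r i ≤ 1)
    (hp : ∀ i, TrajectoryPMB.IsDensity (TrajectoryPMB.trajMeasure d k) (p i))
    -- the law of the set of (alive or all) trajectories at time step `k`
    (P : MeasureTheory.Measure (TrajectoryPMB.FinSets (TrajectoryPMB.Traj d k)))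
    (hP : TrajectoryPMB.HasMultiObjectDensity (TrajectoryPMB.trajMeasure d k) P
      (TrajectoryPMB.pmbDensity (TrajectoryPMB.trajMeasure d k) lam r p))
    (hadm : ∀ᵐ S ∂P, ∀ X ∈ S.toFinset, F.Admits k X) :
    -- the predicted law has a PMB density with `n` Bernoulli components, with these parameters
    TrajectoryPMB.HasMultiObjectDensity (TrajectoryPMB.trajMeasure d (k + 1))
        (TrajectoryPMB.predict M F P)
        (TrajectoryPMB.pmbDensity (TrajectoryPMB.trajMeasure d (k + 1))
          (TrajectoryPMB.predIntensity M F lam)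
          (fun i => TrajectoryPMB.predExistence M F (r i) (p i))
          (fun i => TrajectoryPMB.predDensity M F (p i))) ∧
      -- and they are PMB parameters
      TrajectoryPMB.IsIntensity (TrajectoryPMB.trajMeasure d (k + 1))
        (TrajectoryPMB.predIntensity M F lam) ∧
      (∀ i, 0 ≤ TrajectoryPMB.predExistence M F (r i) (p i) ∧
        TrajectoryPMB.predExistence M F (r i) (p i) ≤ 1) ∧
      (∀ i, TrajectoryPMB.pairing (p i) (TrajectoryPMB.survival M F) ≠ 0 →
        TrajectoryPMB.IsDensity (TrajectoryPMB.trajMeasure d (k + 1))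
          (TrajectoryPMB.predDensity M F (p i))) ∧
      -- and the predicted set consists of (alive or all) trajectories at time step `k + 1`
      (∀ᵐ S ∂(TrajectoryPMB.predict M F P), ∀ X ∈ S.toFinset, F.Admits (k + 1) X) := by
  have hpred := TrajectoryPMB.isIntensity_predIntensity M F hlam
  have hlaw := TrajectoryPMB.predict_eq_withDensity M F hd hlam hr hp
  rw [← hP.2] at hlaw
  have hPprob : P Set.univ = 1 := by
    rw [hP.2, withDensity_apply _ MeasurableSet.univ, Measure.restrict_univ]
    exact hP.1.lintegral_eq_one
  -- the predicted density has integral one, since the transition preserves the total mass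
  have hprob : TrajectoryPMB.predict M F P Set.univ = 1 := by
    rw [TrajectoryPMB.predict, Measure.bind_apply MeasurableSet.univ
      (TrajectoryPMB.measurable_multiTransition M F).aemeasurable]
    simp [hPprob]
  refine ⟨⟨⟨TrajectoryPMB.measurable_pmbDensity hpred.measurable fun i =>
    TrajectoryPMB.measurable_predDensity M F (hp i).measurable,
    TrajectoryPMB.pmbDensity_nonneg hpred.nonneg
      (fun i => TrajectoryPMB.predExistence_mem M F (hr i) (hp i))
      fun i => TrajectoryPMB.predDensity_nonneg M F (hp i).nonneg, ?_⟩, hlaw⟩, hpred,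
    fun i => TrajectoryPMB.predExistence_mem M F (hr i) (hp i),
    fun i => TrajectoryPMB.isDensity_predDensity M F (hp i),
    TrajectoryPMB.ae_predict_admits M F hadm⟩
  rw [← hprob, hlaw, withDensity_apply _ MeasurableSet.univ, Measure.restrict_univ]
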